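/- Let $\mathbb I=\mathrm{diag}(d_1,d_2,d_3)$ with $d_i>0$, let $a<b$, $\Omega_a,\Omega_b\in\mathbb R^3$, and let $\Omega,\xi:\mathbb R\to\mathbb R^3$ be twice differentiable with $\xi(t)\neq 0$ on $[a,b]$. The terminal time $b$ is either fixed or free. Put $$q=\langle\xi,\mathbb I^{-1}\xi\rangle\,[\mathbb I\dot\Omega-(\mathbb I\Omega)\times\Omega]+n\,\xi,\qquad n=\langle\Omega,\dot\xi\rangle+\langle(\mathbb I\Omega)\times\Omega,\mathbb I^{-1}\xi\rangle ,$$ so that $q=0$ are Suslov's pure equations of motion for $G=SO(3)$. For a cost $C(\Omega,\dot\Omega,\xi,\dot\xi,t)$ (continuous, with derivative in its first four arguments jointly continuous, and with $\partial C/\partial\dot\Omega$, $\partial C/\partial\dot\xi$ differentiable; e.g. any $C^2$ function), multipliers $\rho,\nu\in\mathbb R^3$ and a differentiable costate $\kappa:\mathbb R\to\mathbb R^3$ let $$S=\langle\rho,\Omega(a)-\Omega_a\rangle+\langle\nu,\Omega(b)-\Omega_b\rangle+\int_a^b\big[C+\langle\kappa,q\rangle\big]\,dt .$$ Write $P=\langle\xi,\mathbb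 I^{-1}\xi\rangle\mathbb I\kappa+(\partial C/\partial\dot\Omega)^{\mathsf T}$ and $Q=\langle\kappa,\xi\rangle\Omega+(\partial C/\partial\dot\xi)^{\mathsf T}$. **(1) Necessary conditions.** The differential $dS$ vanishes for all differentiable $\delta\kappa$, all twice differentiable $\delta\Omega,\delta\xi$ with $\delta\Omega(a)=0$, and all $d\rho,d\nu,db$ ($db=0$ if $b$ is fixed) if and only if $\nu=-P(b)$ and the following two-point boundary value problem (TPBVP) holds: on $[a,b]$, $$\dot\Omega=\frac{\mathbb I^{-1}}{\langle\xi,\mathbb I^{-1}\xi\rangle}\big\{\langle\xi,\mathbb I^{-1}\xi\rangle(\mathbb I\Omega)\times\Omega-n\,\xi\big\},$$ $$\dot\kappa=\frac{\mathbb I^{-1}}{\langle\xi,\mathbb I^{-1}\xi\rangle}\Big\{\Big(\frac{\partial C}{\partial\Omega}-\frac{d}{dt}\frac{\partial C}{\partial\dot\Omega}\Big)^{\mathsf T}+K\Big\},$$ $$\Big(\frac{d}{dt}\frac{\partial C}{\partial\dot\xi}\Big)^{\mathsf T}=\Big(\frac{\partial C}{\partial\xi}\Big)^{\mathsf T}+R-\Omega\,\xi^{\mathsf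 T}\dot\kappa,$$ where $$K=-\langle\xi,\mathbb I^{-1}\xi\rangle[\mathbb I(\Omega\times\kappa)+\kappa\times(\mathbb I\Omega)]+\langle\kappa,\xi\rangle[\dot\xi+\mathbb I(\Omega\times\mathbb I^{-1}\xi)+(\mathbb I^{-1}\xi)\times(\mathbb I\Omega)]-2\langle\dot\xi,\mathbb I^{-1}\xi\rangle\mathbb I\kappa,$$ $$R=-2\langle\kappa,(\mathbb I\Omega)\times\Omega\rangle\mathbb I^{-1}\xi+\langle\kappa,\xi\rangle\mathbb I^{-1}((\mathbb I\Omega)\times\Omega)+n\,\kappa-\langle\kappa,\dot\xi\rangle\Omega-\big[\langle\kappa,\xi\rangle I-2\,\mathbb I^{-1}\xi(\mathbb I\kappa)^{\mathsf T}\big]\dot\Omega ,$$ together with $\Omega(a)=\Omega_a$, $Q(a)=0$, $\Omega(b)=\Omega_b$, $Q(b)=0$ and, if $b$ is free, $[C-\langle P,\dot\Omega\rangle]_{t=b}=0$. In particular the TPBVP holds whenever $q=0$ on $[a,b]$, $\Omega(a)=\Omega_a$, $\Omega(b)=\Omega_b$, and, for the given $\kappa,\rho,\nu$, the triple $(\Omega,\xi,b)$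 minimizes $S$ locally along every family $(\Omega+\epsilon\,\delta\Omega,\ \xi+\epsilon\,\delta\xi,\ b+\epsilon\,db)$ of the above kind. **(2) Classical costates.** Let $f(\Omega,\xi,u)$ be the right-hand side of the first equation with $\dot\xi$ replaced by $u$, and let $H=C(\Omega,f(\Omega,\xi,u),\xi,u,t)+\langle\pi_d,f(\Omega,\xi,u)\rangle+\langle\pi_e,u\rangle$ be the classical Hamiltonian with state $x=(\Omega,\xi)$, control $u=\dot\xi$ and costate $\pi=(\pi_d,\pi_e)\in\mathbb R^6$. Then $(\kappa,\Omega,\xi)$ solves the TPBVP if and only if $$\pi=-\begin{bmatrix}\langle\xi,\mathbb I^{-1}\xi\rangle\mathbb I\kappa+(\partial C/\partial\dot\Omega)^{\mathsf T}\\ \langle\kappa,\xi\rangle\Omega+(\partial C/\partial\dot\xi)^{\mathsf T}\end{bmatrix}$$ satisfies the classical conditions $\dot x=H_\pi$, $\dot\pi=-H_x$, $H_u=0$ on $[a,b]$, $\Omega(a)=\Omega_a$, $\pi_e(a)=0$, $\Omega(b)=\Omega_b$, $\pi_e(b)=0$ and, if $b$ is free, $H|_{t=b}=0$. Conversely, every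 differentiable $\pi$ satisfying the classical conditions with $(\Omega,\xi)$ is given on $[a,b]$ by this formula for some differentiable $\kappa$ such that $(\kappa,\Omega,\xi)$ solves the TPBVP. **(3) Explicit form.** Let $C=\frac\alpha4(|\xi|^2-1)^2+\frac\beta2|\dot\xi|^2+\frac\gamma2|\Omega-\Omega_d(t)|^2+\frac\eta2|\dot\Omega|^2+\delta$ with $\alpha,\gamma,\eta,\delta\ge0$, $\beta>0$. If $\Omega_d$ is continuous, this $C$ has the regularity required above. For all $\Omega\in\mathbb R^3$ and $0\ne\xi\in\mathbb R^3$ the matrix $\beta I+\frac{\eta\langle\xi,\mathbb I^{-2}\xi\rangle}{\langle\xi,\mathbb I^{-1}\xi\rangle^2}\Omega\Omega^{\mathsf T}$ is invertible with inverse $$N=\frac1\beta\Big[I-\frac{\eta\langle\xi,\mathbb I^{-2}\xi\rangle}{\beta\langle\xi,\mathbb I^{-1}\xi\rangle^2+\eta\langle\xi,\mathbb I^{-2}\xi\rangle\langle\Omega,\Omega\rangle}\,\Omega\Omega^{\mathsf T}\Big]$$ (Sherman–Morrison). For every $\Omega_d:\mathbb R\to\mathbb R^3$ the TPBVP for this $C$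 is equivalent to the explicit system on $[a,b]$ $$\dot\Omega=f(\Omega,\xi,\dot\xi),\qquad \ddot\xi=N\{h-\Omega\langle\xi,g\rangle\},\qquad \dot\kappa=g+\frac{\eta\langle\Omega,\ddot\xi\rangle}{\langle\xi,\mathbb I^{-1}\xi\rangle^2}\mathbb I^{-2}\xi$$ with the boundary conditions $\Omega(a)=\Omega_a$, $[\langle\kappa,\xi\rangle\Omega+\beta\dot\xi]_{t=a}=0$, $\Omega(b)=\Omega_b$, $[\langle\kappa,\xi\rangle\Omega+\beta\dot\xi]_{t=b}=0$ and, if $b$ is free, $$\Big[\tfrac\alpha4(|\xi|^2-1)^2+\tfrac\beta2|\dot\xi|^2+\tfrac\gamma2|\Omega-\Omega_d|^2+\delta-\tfrac\eta2|\dot\Omega|^2-\langle\langle\xi,\mathbb I^{-1}\xi\rangle\mathbb I\kappa,\dot\Omega\rangle\Big]_{t=b}=0 .$$ Here $h=\alpha(|\xi|^2-1)\xi+R$ and $$g=\frac{\mathbb I^{-1}}{\langle\xi,\mathbb I^{-1}\xi\rangle}\Big\{\gamma(\Omega-\Omega_d)-\eta\,\mathbb I^{-1}\Big\{(\mathbb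 I\dot\Omega)\times\Omega+(\mathbb I\Omega)\times\dot\Omega-\tfrac{n}{\langle\xi,\mathbb I^{-1}\xi\rangle}\dot\xi-\tfrac{\langle\xi,\mathbb I^{-1}\xi\rangle\dot n_1-2n\langle\dot\xi,\mathbb I^{-1}\xi\rangle}{\langle\xi,\mathbb I^{-1}\xi\rangle^2}\xi\Big\}+K\Big\},$$ $$\dot n_1=\langle\dot\Omega,\dot\xi\rangle+\langle(\mathbb I\dot\Omega)\times\Omega+(\mathbb I\Omega)\times\dot\Omega,\mathbb I^{-1}\xi\rangle+\langle(\mathbb I\Omega)\times\Omega,\mathbb I^{-1}\dot\xi\rangle,$$ with $\dot\Omega=f(\Omega,\xi,\dot\xi)$ substituted in $g$ and $h$, so that the right-hand sides depend only on $t,\Omega,\xi,\dot\xi,\kappa$. -/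

import Mathlib

open Set
open scoped Matrix

noncomputable section

/-- Vectors of `ℝ³` in the body frame; the pairing is the scalar product `⬝ᵥ`. -/
abbrev Vec3 : Type := Fin 3 → ℝ

/-- The inertia matrix `𝕀 = diag (d₁, d₂, d₃)` applied to a vector. -/
def inertia (d : Vec3) (x : Vec3) : Vec3 := fun i => d i * x i

/-- The inverse inertia matrix `𝕀⁻¹ = diag (1/d₁, 1/d₂, 1/d₃)` applied to a vector. -/
def inertiaInv (d : Vec3) (x : Vec3) : Vec3 := fun i => (d i)⁻¹ * x i

/-- The scalar `⟨ξ, 𝕀⁻¹ ξ⟩`. -/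
def xiSq (d ξ : Vec3) : ℝ := ξ ⬝ᵥ inertiaInv d ξ

/-- The scalar `⟨ξ, 𝕀⁻² ξ⟩`. -/
def xiSq2 (d ξ : Vec3) : ℝ := ξ ⬝ᵥ inertiaInv d (inertiaInv d ξ)

/-- The vector `(𝕀 Ω) × Ω`. -/
def gyro (d Ω : Vec3) : Vec3 := (inertia d Ω) ⨯₃ Ω

/-- The scalar `⟨Ω, ξ̇⟩ + ⟨(𝕀 Ω) × Ω, 𝕀⁻¹ ξ⟩`; the arguments are the values of `Ω`, `ξ`, `ξ̇`. -/
def nOne (d Ω ξ ξ' : Vec3) : ℝ := Ω ⬝ᵥ ξ' + gyro d Ω ⬝ᵥ inertiaInv d ξ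

/-- The left-hand side `q` of Suslov's pure equations of motion `q = 0`:
`q = ⟨ξ, 𝕀⁻¹ξ⟩ [𝕀 Ω̇ - (𝕀 Ω) × Ω] + [⟨Ω, ξ̇⟩ + ⟨(𝕀 Ω) × Ω, 𝕀⁻¹ξ⟩] ξ`.
The arguments are the values of `Ω`, `Ω̇`, `ξ`, `ξ̇`. -/
def suslovQ (d Ω Ω' ξ ξ' : Vec3) : Vec3 :=
  xiSq d ξ • (inertia d Ω' - gyro d Ω) + nOne d Ω ξ ξ' • ξ

/-- The right-hand side of Suslov's pure equations of motion solved for `Ω̇`. -/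
def omegaDot (d Ω ξ ξ' : Vec3) : Vec3 :=
  (xiSq d ξ)⁻¹ • inertiaInv d (xiSq d ξ • gyro d Ω - nOne d Ω ξ ξ' • ξ)

/-- The gradient (transposed derivative) of a real function on `ℝ³`. -/
def vgrad (f : Vec3 → ℝ) (x : Vec3) : Vec3 := fun i => fderiv ℝ f x (Pi.single i 1)

/-- A cost function `C (Ω, Ω̇, ξ, ξ̇, t)`. -/
abbrev CostFn : Type := Vec3 → Vec3 → Vec3 → Vec3 → ℝ → ℝ

/-- `(∂C/∂Ω)ᵀ` -/
def gradOmega (C : CostFn) : Vec3 → Vec3 → Vec3 → Vec3 → ℝ → Vec3 :=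
  fun Ω Ω' ξ ξ' t => vgrad (fun x => C x Ω' ξ ξ' t) Ω

/-- `(∂C/∂Ω̇)ᵀ` -/
def gradOmegaDot (C : CostFn) : Vec3 → Vec3 → Vec3 → Vec3 → ℝ → Vec3 :=
  fun Ω Ω' ξ ξ' t => vgrad (fun x => C Ω x ξ ξ' t) Ω'

/-- `(∂C/∂ξ)ᵀ` -/
def gradXi (C : CostFn) : Vec3 → Vec3 → Vec3 → Vec3 → ℝ → Vec3 :=
  fun Ω Ω' ξ ξ' t => vgrad (fun x => C Ω Ω' x ξ' t) ξ

/-- `(∂C/∂ξ̇)ᵀ` -/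
def gradXiDot (C : CostFn) : Vec3 → Vec3 → Vec3 → Vec3 → ℝ → Vec3 :=
  fun Ω Ω' ξ ξ' t => vgrad (fun x => C Ω Ω' ξ x t) ξ'

/-- The smoothness of the cost under which its differential and the time derivatives of
`∂C/∂Ω̇` and `∂C/∂ξ̇` along twice differentiable curves make sense. Every `C²` function of
`(Ω, Ω̇, ξ, ξ̇, t)` has these properties; no differentiability of `C` itself in `t` is asked. -/
structure IsRegularCost (C : CostFn) : Prop where
  continuous : Continuous
    (fun p : (Vec3 × Vec3 × Vec3 × Vec3) × ℝ => C p.1.1 p.1.2.1 p.1.2.2.1 p.1.2.2.2 p.2)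
  differentiable : ∀ t : ℝ, Differentiable ℝ
    (fun z : Vec3 × Vec3 × Vec3 × Vec3 => C z.1 z.2.1 z.2.2.1 z.2.2.2 t)
  continuous_fderiv : Continuous (fun p : (Vec3 × Vec3 × Vec3 × Vec3) × ℝ =>
    fderiv ℝ (fun z : Vec3 × Vec3 × Vec3 × Vec3 => C z.1 z.2.1 z.2.2.1 z.2.2.2 p.2) p.1)
  differentiable_gradOmegaDot : Differentiable ℝ (fun p : (Vec3 × Vec3 × Vec3 × Vec3) × ℝ =>
    gradOmegaDot C p.1.1 p.1.2.1 p.1.2.2.1 p.1.2.2.2 p.2)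
  differentiable_gradXiDot : Differentiable ℝ (fun p : (Vec3 × Vec3 × Vec3 × Vec3) × ℝ =>
    gradXiDot C p.1.1 p.1.2.1 p.1.2.2.1 p.1.2.2.2 p.2)

/-- Evaluation of a function of `(Ω, Ω̇, ξ, ξ̇, t)` along a trajectory. -/
def along {A : Type*} (F : Vec3 → Vec3 → Vec3 → Vec3 → ℝ → A) (Ω ξ : ℝ → Vec3) (t : ℝ) : A :=
  F (Ω t) (deriv Ω t) (ξ t) (deriv ξ t) t

/-- `f` is twice differentiable. -/
def TwiceDifferentiable (f : ℝ → Vec3) : Prop :=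
  Differentiable ℝ f ∧ Differentiable ℝ (deriv f)

/-! ### The performance index and its differential -/

/-- The performance index
`S = ⟨ρ, Ω(a) - Ω_a⟩ + ⟨ν, Ω(b) - Ω_b⟩ + ∫_a^b [C + ⟨κ, q⟩] dt`. -/
def performanceIndex (d : Vec3) (C : CostFn) (a : ℝ) (Ωa Ωb : Vec3)
    (κ Ω ξ : ℝ → Vec3) (ρ ν : Vec3) (b : ℝ) : ℝ :=
  ρ ⬝ᵥ (Ω a - Ωa) + ν ⬝ᵥ (Ω b - Ωb) +
    ∫ t in a..b, (along C Ω ξ t +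
      κ t ⬝ᵥ suslovQ d (Ω t) (deriv Ω t) (ξ t) (deriv ξ t))

/-- The allowed variations of the trajectory and of the terminal time: `Ω(a)` is held fixed, and
the terminal time is varied only if it is free. -/
structure IsVariation (a : ℝ) (freeTime : Prop) (δΩ δξ : ℝ → Vec3) (db : ℝ) : Prop where
  omega : TwiceDifferentiable δΩ
  xi : TwiceDifferentiable δξ
  left : δΩ a = 0
  fixed : ¬ freeTime → db = 0

/-- `dS = 0`: the first-order change of `S` vanishes for all variations `δκ`, `δΩ`, `δξ` and all
differentials `dρ`, `dν`, `db`. -/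
def IsStationaryIndex (d : Vec3) (C : CostFn) (a : ℝ) (Ωa Ωb : Vec3) (freeTime : Prop)
    (κ Ω ξ : ℝ → Vec3) (ρ ν : Vec3) (b : ℝ) : Prop :=
  ∀ (δκ δΩ δξ : ℝ → Vec3) (dρ dν : Vec3) (db : ℝ),
    Differentiable ℝ δκ → IsVariation a freeTime δΩ δξ db →
    HasDerivAt (fun ε : ℝ => performanceIndex d C a Ωa Ωb
      (κ + ε • δκ) (Ω + ε • δΩ) (ξ + ε • δξ) (ρ + ε • dρ) (ν + ε • dν) (b + ε * db)) 0 0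

/-- The trajectory satisfies the constraints of the optimal control problem. -/
structure IsFeasible (d : Vec3) (a b : ℝ) (Ωa Ωb : Vec3) (Ω ξ : ℝ → Vec3) : Prop where
  motion : ∀ t ∈ Icc a b, suslovQ d (Ω t) (deriv Ω t) (ξ t) (deriv ξ t) = 0
  left : Ω a = Ωa
  right : Ω b = Ωb

/-- For the given multipliers `κ, ρ, ν`, the triple `(Ω, ξ, b)` minimizes `S` locally along every
one-parameter family `(Ω + ε δΩ, ξ + ε δξ, b + ε db)`. -/
def IsMinimizingIndex (d : Vec3) (C : CostFn) (a : ℝ) (Ωa Ωb : Vec3) (freeTime : Prop)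
    (κ Ω ξ : ℝ → Vec3) (ρ ν : Vec3) (b : ℝ) : Prop :=
  ∀ (δΩ δξ : ℝ → Vec3) (db : ℝ), IsVariation a freeTime δΩ δξ db →
    IsLocalMin (fun ε : ℝ => performanceIndex d C a Ωa Ωb
      κ (Ω + ε • δΩ) (ξ + ε • δξ) ρ ν (b + ε * db)) 0

/-! ### Suslov's optimally controlled equations -/

/-- `⟨ξ, 𝕀⁻¹ξ⟩ 𝕀 κ + (∂C/∂Ω̇)ᵀ` along a trajectory. -/
def momOmega (d : Vec3) (C : CostFn) (κ Ω ξ : ℝ → Vec3) (t : ℝ) : Vec3 :=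
  xiSq d (ξ t) • inertia d (κ t) + along (gradOmegaDot C) Ω ξ t

/-- `⟨κ, ξ⟩ Ω + (∂C/∂ξ̇)ᵀ` along a trajectory. -/
def momXi (C : CostFn) (κ Ω ξ : ℝ → Vec3) (t : ℝ) : Vec3 :=
  (κ t ⬝ᵥ ξ t) • Ω t + along (gradXiDot C) Ω ξ t

/-- The bracket common to all versions of the costate equation:
`-⟨ξ, 𝕀⁻¹ξ⟩ [𝕀 (Ω × κ) + κ × (𝕀 Ω)]
  + ⟨κ, ξ⟩ [ξ̇ + 𝕀 (Ω × 𝕀⁻¹ξ) + (𝕀⁻¹ξ) × (𝕀 Ω)] - 2 ⟨ξ̇, 𝕀⁻¹ξ⟩ 𝕀 κ`. -/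
def costateBracket (d κ Ω ξ ξ' : Vec3) : Vec3 :=
  -(xiSq d ξ • (inertia d (Ω ⨯₃ κ) + κ ⨯₃ (inertia d Ω)))
    + (κ ⬝ᵥ ξ) • (ξ' + inertia d (Ω ⨯₃ (inertiaInv d ξ)) + (inertiaInv d ξ) ⨯₃ (inertia d Ω))
    - (2 * (ξ' ⬝ᵥ inertiaInv d ξ)) • inertia d κ

/-- The bracket common to all versions of the control equation:
`-2 ⟨κ, (𝕀 Ω) × Ω⟩ 𝕀⁻¹ξ + ⟨κ, ξ⟩ 𝕀⁻¹((𝕀 Ω) × Ω)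
  + [⟨Ω, ξ̇⟩ + ⟨(𝕀 Ω) × Ω, 𝕀⁻¹ξ⟩] κ - ⟨κ, ξ̇⟩ Ω - [⟨κ, ξ⟩ I - 2 𝕀⁻¹ξ (𝕀 κ)ᵀ] Ω̇`. -/
def controlBracket (d κ Ω Ω' ξ ξ' : Vec3) : Vec3 :=
  -((2 * (κ ⬝ᵥ gyro d Ω)) • inertiaInv d ξ)
    + (κ ⬝ᵥ ξ) • inertiaInv d (gyro d Ω)
    + nOne d Ω ξ ξ' • κ
    - (κ ⬝ᵥ ξ') • Ω
    - ((κ ⬝ᵥ ξ) • (1 : Matrix (Fin 3) (Fin 3) ℝ)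
        - (2 : ℝ) • Matrix.vecMulVec (inertiaInv d ξ) (inertia d κ)) *ᵥ Ω'

/-- The two-point boundary value problem on `[a, b]` for `κ, Ω, ξ` (and `b`, if the terminal time
is free): the equations of motion, the left and the right boundary conditions. -/
structure OptimallyControlled (d : Vec3) (C : CostFn) (a b : ℝ) (Ωa Ωb : Vec3)
    (freeTime : Prop) (κ Ω ξ : ℝ → Vec3) : Prop where
  omega_eq : ∀ t ∈ Icc a b, deriv Ω t = omegaDot d (Ω t) (ξ t) (deriv ξ t)
  kappa_eq : ∀ t ∈ Icc a b, deriv κ t = (xiSq d (ξ t))⁻¹ • inertiaInv d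
    (along (gradOmega C) Ω ξ t - deriv (along (gradOmegaDot C) Ω ξ) t
      + costateBracket d (κ t) (Ω t) (ξ t) (deriv ξ t))
  xi_eq : ∀ t ∈ Icc a b, deriv (along (gradXiDot C) Ω ξ) t =
    along (gradXi C) Ω ξ t
      + controlBracket d (κ t) (Ω t) (deriv Ω t) (ξ t) (deriv ξ t)
      - (ξ t ⬝ᵥ deriv κ t) • Ω t
  left_omega : Ω a - Ωa = 0
  left_xi : momXi C κ Ω ξ a = 0
  right_omega : Ω b - Ωb = 0
  right_xi : momXi C κ Ω ξ b = 0
  right_time : freeTime → along C Ω ξ b - momOmega d C κ Ω ξ b ⬝ᵥ deriv Ω b = 0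

/-! ### The classical Hamiltonian system with six costates -/

/-- The classical Hamiltonian `H = L(Ω, ξ, u, t) + ⟨π, (f(Ω, ξ, u), u)⟩` with state `(Ω, ξ)`,
control `u = ξ̇`, costate `π = (p, r) ∈ ℝ³ × ℝ³`, where `f = omegaDot` and
`L(Ω, ξ, u, t) = C(Ω, f(Ω, ξ, u), ξ, u, t)`. -/
def hamiltonian (d : Vec3) (C : CostFn) (Ω ξ u p r : Vec3) (t : ℝ) : ℝ :=
  C Ω (omegaDot d Ω ξ u) ξ u t + (p ⬝ᵥ omegaDot d Ω ξ u + r ⬝ᵥ u)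

/-- The classical necessary conditions on `[a, b]` for the state `(Ω, ξ)`, the control `u = ξ̇` and
the costate `π = (p, r)`: `ẋ = H_π`, `π̇ = -H_x`, `H_u = 0` and the boundary conditions. (The
`Ω`-components of the transversality conditions only determine the constant multipliers of the
constraints on `Ω(a)` and `Ω(b)`.) -/
structure ClassicalConditions (d : Vec3) (C : CostFn) (a b : ℝ) (Ωa Ωb : Vec3)
    (freeTime : Prop) (Ω ξ p r : ℝ → Vec3) : Prop where
  omega_eq : ∀ t ∈ Icc a b, deriv Ω t =
    vgrad (fun x => hamiltonian d C (Ω t) (ξ t) (deriv ξ t) x (r t) t) (p t)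
  xi_eq : ∀ t ∈ Icc a b, deriv ξ t =
    vgrad (fun x => hamiltonian d C (Ω t) (ξ t) (deriv ξ t) (p t) x t) (r t)
  p_eq : ∀ t ∈ Icc a b, deriv p t =
    -vgrad (fun x => hamiltonian d C x (ξ t) (deriv ξ t) (p t) (r t) t) (Ω t)
  r_eq : ∀ t ∈ Icc a b, deriv r t =
    -vgrad (fun x => hamiltonian d C (Ω t) x (deriv ξ t) (p t) (r t) t) (ξ t)
  optimality : ∀ t ∈ Icc a b,
    vgrad (fun u => hamiltonian d C (Ω t) (ξ t) u (p t) (r t) t) (deriv ξ t) = 0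
  left_omega : Ω a = Ωa
  left_r : r a = 0
  right_omega : Ω b = Ωb
  right_r : r b = 0
  right_time : freeTime → hamiltonian d C (Ω b) (ξ b) (deriv ξ b) (p b) (r b) b = 0

/-! ### The particular cost function and the explicit system -/

/-- `C = α/4 (|ξ|² - 1)² + β/2 |ξ̇|² + γ/2 |Ω - Ω_d(t)|² + η/2 |Ω̇|² + δ`. -/
def suslovCost (α β γ η δ : ℝ) (Ωd : ℝ → Vec3) : CostFn := fun Ω Ω' ξ ξ' t =>
  α / 4 * (ξ ⬝ᵥ ξ - 1) ^ 2 + β / 2 * (ξ' ⬝ᵥ ξ')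
    + γ / 2 * ((Ω - Ωd t) ⬝ᵥ (Ω - Ωd t)) + η / 2 * (Ω' ⬝ᵥ Ω') + δ

/-- `ṅ₁ = ⟨Ω̇, ξ̇⟩ + ⟨(𝕀 Ω̇) × Ω + (𝕀 Ω) × Ω̇, 𝕀⁻¹ξ⟩ + ⟨(𝕀 Ω) × Ω, 𝕀⁻¹ξ̇⟩`. -/
def nOneDot (d Ω Ω' ξ ξ' : Vec3) : ℝ :=
  Ω' ⬝ᵥ ξ' + ((inertia d Ω') ⨯₃ Ω + (inertia d Ω) ⨯₃ Ω') ⬝ᵥ inertiaInv d ξ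
    + gyro d Ω ⬝ᵥ inertiaInv d ξ'

/-- The vector `g`, a function of the values of `Ω_d`, `Ω`, `ξ`, `ξ̇`, `κ`. -/
def gVec (d : Vec3) (γ η : ℝ) (Ωd Ω ξ ξ' κ : Vec3) : Vec3 :=
  let Ω' := omegaDot d Ω ξ ξ'
  (xiSq d ξ)⁻¹ • inertiaInv d
    (γ • (Ω - Ωd)
      - η • inertiaInv d
        ((inertia d Ω') ⨯₃ Ω + (inertia d Ω) ⨯₃ Ω'
          - (nOne d Ω ξ ξ' / xiSq d ξ) • ξ'
          - ((xiSq d ξ * nOneDot d Ω Ω' ξ ξ'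
              - 2 * nOne d Ω ξ ξ' * (ξ' ⬝ᵥ inertiaInv d ξ)) / xiSq d ξ ^ 2) • ξ)
      + costateBracket d κ Ω ξ ξ')

/-- The vector `h`, a function of the values of `Ω`, `ξ`, `ξ̇`, `κ`. -/
def hVec (d : Vec3) (α : ℝ) (Ω ξ ξ' κ : Vec3) : Vec3 :=
  (α * (ξ ⬝ᵥ ξ - 1)) • ξ + controlBracket d κ Ω (omegaDot d Ω ξ ξ') ξ ξ'

/-- The matrix `β I + η ⟨ξ, 𝕀⁻²ξ⟩ / ⟨ξ, 𝕀⁻¹ξ⟩² Ω Ωᵀ` multiplying `ξ̈`. -/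
def xiMatrix (d : Vec3) (β η : ℝ) (Ω ξ : Vec3) : Matrix (Fin 3) (Fin 3) ℝ :=
  β • (1 : Matrix (Fin 3) (Fin 3) ℝ)
    + (η * xiSq2 d ξ / xiSq d ξ ^ 2) • Matrix.vecMulVec Ω Ω

/-- The matrix
`1/β [I - η ⟨ξ, 𝕀⁻²ξ⟩ / (β ⟨ξ, 𝕀⁻¹ξ⟩² + η ⟨ξ, 𝕀⁻²ξ⟩ ⟨Ω, Ω⟩) Ω Ωᵀ]`. -/
def xiMatrixInv (d : Vec3) (β η : ℝ) (Ω ξ : Vec3) : Matrix (Fin 3) (Fin 3) ℝ :=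
  β⁻¹ • ((1 : Matrix (Fin 3) (Fin 3) ℝ)
    - (η * xiSq2 d ξ / (β * xiSq d ξ ^ 2 + η * xiSq2 d ξ * (Ω ⬝ᵥ Ω))) • Matrix.vecMulVec Ω Ω)

/-- The explicit right-hand side for `ξ̈`, a function of the values of `Ω_d`, `Ω`, `ξ`, `ξ̇`, `κ`. -/
def xiDDot (d : Vec3) (α β γ η : ℝ) (Ωd Ω ξ ξ' κ : Vec3) : Vec3 :=
  xiMatrixInv d β η Ω ξ *ᵥ
    (hVec d α Ω ξ ξ' κ - (ξ ⬝ᵥ gVec d γ η Ωd Ω ξ ξ' κ) • Ω)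

/-- The explicit right-hand side for `κ̇`, a function of the values of `Ω_d`, `Ω`, `ξ`, `ξ̇`, `κ`. -/
def kappaDot (d : Vec3) (α β γ η : ℝ) (Ωd Ω ξ ξ' κ : Vec3) : Vec3 :=
  gVec d γ η Ωd Ω ξ ξ' κ
    + (η * (Ω ⬝ᵥ xiDDot d α β γ η Ωd Ω ξ ξ' κ) / xiSq d ξ ^ 2) •
        inertiaInv d (inertiaInv d ξ)

/-- The explicit two-point boundary value problem for the particular cost function. -/
structure ExplicitlyControlled (d : Vec3) (α β γ η δ : ℝ) (Ωd : ℝ → Vec3) (a b : ℝ)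
    (Ωa Ωb : Vec3) (freeTime : Prop) (κ Ω ξ : ℝ → Vec3) : Prop where
  omega_eq : ∀ t ∈ Icc a b, deriv Ω t = omegaDot d (Ω t) (ξ t) (deriv ξ t)
  xi_eq : ∀ t ∈ Icc a b,
    deriv (deriv ξ) t = xiDDot d α β γ η (Ωd t) (Ω t) (ξ t) (deriv ξ t) (κ t)
  kappa_eq : ∀ t ∈ Icc a b,
    deriv κ t = kappaDot d α β γ η (Ωd t) (Ω t) (ξ t) (deriv ξ t) (κ t)
  left_omega : Ω a - Ωa = 0
  left_xi : (κ a ⬝ᵥ ξ a) • Ω a + β • deriv ξ a = 0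
  right_omega : Ω b - Ωb = 0
  right_xi : (κ b ⬝ᵥ ξ b) • Ω b + β • deriv ξ b = 0
  right_time : freeTime →
    α / 4 * (ξ b ⬝ᵥ ξ b - 1) ^ 2 + β / 2 * (deriv ξ b ⬝ᵥ deriv ξ b)
      + γ / 2 * ((Ω b - Ωd b) ⬝ᵥ (Ω b - Ωd b)) + δ
      - η / 2 * (deriv Ω b ⬝ᵥ deriv Ω b)
      - (xiSq d (ξ b) • inertia d (κ b)) ⬝ᵥ deriv Ω b = 0

end

noncomputable section

open Filter Topology MeasureTheory intervalIntegral

/-! ### Integrals depending on a parameter -/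

/-! The constraint enters as a Lagrangian `C + ⟨κ, q⟩`, and one polynomial identity,
`dotProduct_suslovQDiff`, transposes the differential of `q`. It shows that `momOmega` and `momXi`
are the momenta of this Lagrangian. The first variation of `S` (`hasDerivAt_performanceIndex`) is
therefore an integral of `δκ`, `δΩ`, `δΩ̇`, `δξ`, `δξ̇` paired with `q`, forces and momenta, plus
boundary terms. Taking `δκ = q` gives the equations of motion, and the du Bois-Reymond lemma gives
the Euler-Lagrange equations with `momXi = 0` at both ends and `ν = -P(b)`. Varying `b` gives the
transversality condition. Integration by parts yields the converse. Since `ξ ≠ 0` makes `⟨ξ, 𝕀⁻¹ξ⟩`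
positive, `EulerLagrange` can be solved for `Ω̇` and `κ̇`, which is the stated boundary value
problem.

For the classical costates, the identity `q(Ω, f(Ω, ξ, u), ξ, u) = 0` is differentiated and paired
with `κ`. If `π_d = -P`, this eliminates the derivative of `f` from the derivative of `H`
(`hasDerivAt_hamiltonian`): the state gradients of `H` become the Euler-Lagrange forces, and `H_u =
Q + π_e`. Conversely, `π_d = -P` is solved for `κ`, and `H_u = 0` then forces `π_e = -Q`.

For the particular cost, differentiating `q = 0` along the trajectory expresses `Ω̈` affinely
through `⟨Ω, ξ̈⟩`. The control equation becomes a linear system for `ξ̈` whose matrix is a rank-one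
perturbation of `β I`, inverted by Sherman-Morrison. -/

/-- Joint continuity bounds `F'` on the compact set `[x - 1, x + 1] × [a, b]`, and this constant
serves as the dominating function. -/
theorem hasDerivAt_integral_of_continuous {F F' : ℝ → ℝ → ℝ}
    (hF : Continuous (Function.uncurry F)) (hF' : Continuous (Function.uncurry F'))
    (h : ∀ ε t, HasDerivAt (fun e => F e t) (F' ε t) ε) (a b x : ℝ) :
    HasDerivAt (fun e => ∫ t in a..b, F e t) (∫ t in a..b, F' x t) x := by
  have hK : IsCompact (Icc (x - 1) (x + 1) ×ˢ uIcc a b) := isCompact_Icc.prod isCompact_uIcc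
  obtain ⟨M, hM⟩ := hK.exists_bound_of_continuousOn hF'.continuousOn
  have hsec : ∀ {G : ℝ → ℝ → ℝ}, Continuous (Function.uncurry G) → ∀ e, Continuous (G e) :=
    fun hG e => hG.comp (Continuous.prodMk_right e)
  refine (hasDerivAt_integral_of_dominated_loc_of_deriv_le (bound := fun _ => M)
    (Icc_mem_nhds (by linarith : x - 1 < x) (by linarith : x < x + 1))
    (Eventually.of_forall fun e => (hsec hF e).aestronglyMeasurable)
    ((hsec hF x).intervalIntegrable a b) (hsec hF' x).aestronglyMeasurable ?_
    intervalIntegrable_const ?_).2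
  · exact Eventually.of_forall fun t ht e he => hM (e, t) ⟨he, uIoc_subset_uIcc ht⟩
  · exact Eventually.of_forall fun t _ e _ => h e t

/-- The substitution `t = b + e c s` writes the integral as `e` times a continuous function of `e`,
so the difference quotient at `0` converges without any differentiability of `F`. -/
theorem hasDerivAt_integral_right_endpoint {F : ℝ → ℝ → ℝ}
    (hF : Continuous (Function.uncurry F)) (b c : ℝ) :
    HasDerivAt (fun e => ∫ t in b..b + e * c, F e t) (c * F 0 b) 0 := by
  have key : ∀ e, ∫ t in b..b + e * c, F e t = e * (c * ∫ s in (0 : ℝ)..1, F e (b + e * c * s)) := by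
    intro e
    have := intervalIntegral.smul_integral_comp_add_mul (a := 0) (b := 1) (F e) (e * c) b
    rw [mul_zero, mul_one, add_zero] at this
    rw [← this, smul_eq_mul, mul_assoc]
  have hc : Continuous fun e : ℝ => c * ∫ s in (0 : ℝ)..1, F e (b + e * c * s) := by
    refine continuous_const.mul (continuous_parametric_intervalIntegral_of_continuous' ?_ 0 1)
    exact hF.comp (by fun_prop : Continuous fun p : ℝ × ℝ => (p.1, b + p.1 * c * p.2))
  rw [hasDerivAt_iff_tendsto_slope]
  have h0 := (hc.tendsto 0).mono_left (nhdsWithin_le_nhds (s := {0}ᶜ))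
  simp only [zero_mul, add_zero, intervalIntegral.integral_const, sub_zero, one_smul] at h0
  refine h0.congr' ?_
  filter_upwards [self_mem_nhdsWithin] with e he
  have he' : e ≠ 0 := he
  simp only [slope_def_field]
  rw [key e]
  simp [he']

theorem hasDerivAt_integral_moving_endpoint {F F' : ℝ → ℝ → ℝ}
    (hF : Continuous (Function.uncurry F)) (hF' : Continuous (Function.uncurry F'))
    (h : ∀ ε t, HasDerivAt (fun e => F e t) (F' ε t) ε) (a b c : ℝ) :
    HasDerivAt (fun e => ∫ t in a..b + e * c, F e t) ((∫ t in a..b, F' 0 t) + c * F 0 b) 0 := by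
  have hsec : ∀ e, Continuous (F e) := fun e => hF.comp (Continuous.prodMk_right e)
  have := (hasDerivAt_integral_of_continuous hF hF' h a b 0).add
    (hasDerivAt_integral_right_endpoint hF b c)
  refine this.congr_of_eventuallyEq (Eventually.of_forall fun e => ?_)
  exact (integral_add_adjacent_intervals ((hsec e).intervalIntegrable _ _)
    ((hsec e).intervalIntegrable _ _)).symm

/-! ### Scalar products of curves -/

theorem HasDerivAt.vec_apply {x : ℝ → Vec3} {u : Vec3} {t : ℝ} (hx : HasDerivAt x u t) (i : Fin 3) :
    HasDerivAt (fun s => x s i) (u i) t := hasDerivAt_pi.1 hx i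

theorem HasDerivAt.vec_dotProduct {x y : ℝ → Vec3} {u v : Vec3} {t : ℝ}
    (hx : HasDerivAt x u t) (hy : HasDerivAt y v t) :
    HasDerivAt (fun s => x s ⬝ᵥ y s) (u ⬝ᵥ y t + x t ⬝ᵥ v) t := by
  have := HasDerivAt.fun_sum (u := Finset.univ)
    fun i _ => (hx.vec_apply i).fun_mul (hy.vec_apply i)
  simpa only [dotProduct, ← Finset.sum_add_distrib] using this

/-- This is what makes testing a functional against its own coefficient conclusive; it is applied to
`q` and to the difference of a momentum and an antiderivative of the force. -/
theorem eqOn_zero_of_integral_dotProduct_self {f : ℝ → Vec3} {a b : ℝ} (hab : a < b)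
    (hf : Continuous f) (h : ∫ t in a..b, f t ⬝ᵥ f t = 0) : ∀ t ∈ Icc a b, f t = 0 := by
  have hc : Continuous fun t => f t ⬝ᵥ f t := hf.dotProduct hf
  have hnn : ∀ t, 0 ≤ f t ⬝ᵥ f t := fun t => Finset.sum_nonneg fun i _ => mul_self_nonneg _
  intro t ht
  by_contra hne
  have hpos : 0 < f t ⬝ᵥ f t := lt_of_le_of_ne (hnn t) fun h => hne (dotProduct_self_eq_zero.1 h.symm)
  have := intervalIntegral.integral_pos hab hc.continuousOn (fun s _ => hnn s) ⟨t, ht, hpos⟩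
  exact this.ne' h

/-- Integration by parts against a continuous derivative. -/
theorem integral_parts_of_hasDerivAt {P A x x' : ℝ → Vec3} {a b : ℝ} (hab : a ≤ b)
    (hP : ∀ t ∈ Icc a b, HasDerivAt P (A t) t) (hA : Continuous A)
    (hx : ∀ t, HasDerivAt x (x' t) t) (hx' : Continuous x') :
    ∫ t in a..b, (x t ⬝ᵥ A t + x' t ⬝ᵥ P t) = x b ⬝ᵥ P b - x a ⬝ᵥ P a := by
  have hxc : Continuous x := continuous_iff_continuousAt.2 fun t => (hx t).continuousAt
  rw [← uIcc_of_le hab] at hP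
  refine integral_eq_sub_of_hasDerivAt (f := fun t => x t ⬝ᵥ P t) (fun t ht => ?_) ?_
  · simpa only [add_comm] using (hx t).vec_dotProduct (hP t ht)
  · refine ContinuousOn.intervalIntegrable ?_
    have hPc : ContinuousOn P (uIcc a b) := fun t ht => (hP t ht).continuousAt.continuousWithinAt
    have h1 : Continuous fun t => x t ⬝ᵥ A t := hxc.dotProduct hA
    refine h1.continuousOn.add ?_
    simp only [dotProduct]
    refine continuousOn_finsetSum _ fun i _ => ?_
    exact ((continuous_apply i).comp hx').continuousOn.mul
      ((continuous_apply i).comp_continuousOn hPc)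

theorem exists_antideriv {A : ℝ → Vec3} (hA : Continuous A) (b : ℝ) (c : Vec3) :
    ∃ F : ℝ → Vec3, (∀ t, HasDerivAt F (A t) t) ∧ F b = c :=
  ⟨fun t => c + ∫ s in b..t, A s, fun _ => (integral_hasDerivAt_right (hA.intervalIntegrable _ _)
    (hA.stronglyMeasurableAtFilter _ _) hA.continuousAt).const_add c, by simp⟩

/-- Derivatives within a nondegenerate interval are unique even at its endpoints. Identities known
only on `[a, b]` can thus be differentiated at `a` and `b` as well. -/
theorem HasDerivAt.eq_of_eqOn_Icc {E : Type*} [NormedAddCommGroup E] [NormedSpace ℝ E]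
    {f g : ℝ → E} {f' g' : E} {a b t : ℝ} (hab : a < b) (ht : t ∈ Icc a b)
    (hf : HasDerivAt f f' t) (hg : HasDerivAt g g' t) (h : EqOn f g (Icc a b)) : f' = g' :=
  (uniqueDiffOn_Icc hab t ht).eq_deriv _ hf.hasDerivWithinAt
    (hg.hasDerivWithinAt.congr_of_mem h ht)

/-- The lemma of du Bois-Reymond for variations vanishing at the left end. -/
theorem du_bois_reymond {P A : ℝ → Vec3} {ν : Vec3} {a b : ℝ} (hab : a < b)
    (hP : Differentiable ℝ P) (hA : Continuous A)
    (h : ∀ x : ℝ → Vec3, TwiceDifferentiable x → x a = 0 →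
      (∫ t in a..b, (x t ⬝ᵥ A t + deriv x t ⬝ᵥ P t)) + ν ⬝ᵥ x b = 0) :
    (∀ t ∈ Icc a b, deriv P t = A t) ∧ P b = -ν := by
  -- The normalization `F b = -ν` absorbs the boundary term `⟨ν, x b⟩` when the force term is
  -- integrated by parts.
  obtain ⟨F, hF, hFb⟩ := exists_antideriv hA b (-ν)
  have hFd : Differentiable ℝ F := fun t => (hF t).differentiableAt
  have hw : Differentiable ℝ (P - F) := hP.sub hFd
  -- The test variation has `x' = P - F`; it is twice differentiable because `P` and `F` are
  -- differentiable, and it turns the hypothesis into `∫ |P - F|² = 0`.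
  obtain ⟨x, hx, hxa⟩ := exists_antideriv hw.continuous a 0
  have hx' : deriv x = P - F := funext fun t => (hx t).deriv
  have hxd : Differentiable ℝ x := fun t => (hx t).differentiableAt
  have h1 := h x ⟨hxd, hx' ▸ hw⟩ hxa
  have h2 := integral_parts_of_hasDerivAt hab.le (fun t _ => hF t) hA hx hw.continuous
  rw [hx'] at h1
  rw [hFb, hxa, zero_dotProduct, sub_zero, dotProduct_neg, dotProduct_comm] at h2
  have hxA : Continuous fun t => x t ⬝ᵥ A t := hxd.continuous.dotProduct hA
  have hwP : Continuous fun t => (P - F) t ⬝ᵥ P t := hw.continuous.dotProduct hP.continuous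
  have hwF : Continuous fun t => (P - F) t ⬝ᵥ F t := hw.continuous.dotProduct hFd.continuous
  have h3 : ∫ t in a..b, (P - F) t ⬝ᵥ (P - F) t = 0 := by
    have := intervalIntegral.integral_sub ((hxA.add hwP).intervalIntegrable (μ := volume) a b)
      ((hxA.add hwF).intervalIntegrable a b)
    simp only [Pi.add_apply] at this
    rw [h2, eq_neg_of_add_eq_zero_left h1, sub_self] at this
    rw [← this]
    refine intervalIntegral.integral_congr fun t _ => ?_
    simp only [Pi.sub_apply, dotProduct_sub]
    ring
  have h4 := eqOn_zero_of_integral_dotProduct_self hab hw.continuous h3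
  have h5 : EqOn P F (Icc a b) := fun t ht => sub_eq_zero.1 (h4 t ht)
  exact ⟨fun t ht => (hP t).hasDerivAt.eq_of_eqOn_Icc hab ht (hF t) h5,
    (h5 (right_mem_Icc.2 hab.le)).trans hFb⟩

/-- The lemma of du Bois-Reymond for variations that are free at both ends. -/
theorem du_bois_reymond_free {P A : ℝ → Vec3} {a b : ℝ} (hab : a < b)
    (hP : Differentiable ℝ P) (hA : Continuous A)
    (h : ∀ x : ℝ → Vec3, TwiceDifferentiable x →
      ∫ t in a..b, (x t ⬝ᵥ A t + deriv x t ⬝ᵥ P t) = 0) :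
    (∀ t ∈ Icc a b, deriv P t = A t) ∧ P a = 0 ∧ P b = 0 := by
  obtain ⟨h1, h2⟩ := du_bois_reymond (ν := 0) hab hP hA fun x hx _ => by simpa using h x hx
  rw [neg_zero] at h2
  refine ⟨h1, ?_, h2⟩
  have hc : deriv (fun _ : ℝ => P a) = fun _ => 0 := funext fun t => deriv_const t (P a)
  -- With `P b = 0` already known, the constant variation `P a` reduces the integral to `-|P a|²`.
  have h3 := h (fun _ => P a) ⟨differentiable_const _, by rw [hc]; exact differentiable_const _⟩
  have h4 := integral_parts_of_hasDerivAt (x := fun _ => P a) (x' := fun _ => 0) hab.le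
    (fun t ht => h1 t ht ▸ (hP t).hasDerivAt) hA (fun t => hasDerivAt_const t (P a))
    continuous_const
  rw [hc] at h3
  rw [h3, h2, dotProduct_zero, zero_sub, eq_comm, neg_eq_zero] at h4
  exact dotProduct_self_eq_zero.1 h4

/-! ### Differentiation of the equations of motion along curves -/

theorem HasDerivAt.inertia {x : ℝ → Vec3} {u : Vec3} {t : ℝ} (d : Vec3) (hx : HasDerivAt x u t) :
    HasDerivAt (fun s => inertia d (x s)) (inertia d u) t :=
  hasDerivAt_pi.2 fun i => (hx.vec_apply i).const_mul (d i)

theorem HasDerivAt.inertiaInv {x : ℝ → Vec3} {u : Vec3} {t : ℝ} (d : Vec3)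
    (hx : HasDerivAt x u t) : HasDerivAt (fun s => inertiaInv d (x s)) (inertiaInv d u) t :=
  hasDerivAt_pi.2 fun i => (hx.vec_apply i).const_mul (d i)⁻¹

theorem HasDerivAt.cross {x y : ℝ → Vec3} {u v : Vec3} {t : ℝ}
    (hx : HasDerivAt x u t) (hy : HasDerivAt y v t) :
    HasDerivAt (fun s => x s ⨯₃ y s) (u ⨯₃ y t + x t ⨯₃ v) t := by
  have h : ∀ i j, HasDerivAt (fun s => x s i * y s j - x s j * y s i)
      (u i * y t j + x t i * v j - (u j * y t i + x t j * v i)) t := fun i j =>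
    ((hx.vec_apply i).mul (hy.vec_apply j)).sub ((hx.vec_apply j).mul (hy.vec_apply i))
  refine hasDerivAt_pi.2 fun i => ?_
  fin_cases i
  · exact (h 1 2).congr_deriv (by simp [cross_apply]; ring)
  · exact (h 2 0).congr_deriv (by simp [cross_apply]; ring)
  · exact (h 0 1).congr_deriv (by simp [cross_apply]; ring)

/-- The differential of `gyro`. -/
def gyroDiff (d Ω u : Vec3) : Vec3 := (inertia d u) ⨯₃ Ω + (inertia d Ω) ⨯₃ u

theorem HasDerivAt.gyro {x : ℝ → Vec3} {u : Vec3} {t : ℝ} (d : Vec3) (hx : HasDerivAt x u t) :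
    HasDerivAt (fun s => gyro d (x s)) (gyroDiff d (x t) u) t :=
  (hx.inertia d).cross hx

theorem dotProduct_inertiaInv_comm (d x y : Vec3) :
    x ⬝ᵥ inertiaInv d y = y ⬝ᵥ inertiaInv d x := by
  simp only [dotProduct, inertiaInv]
  exact Finset.sum_congr rfl fun i _ => by ring

theorem HasDerivAt.xiSq {y : ℝ → Vec3} {v : Vec3} {t : ℝ} (d : Vec3) (hy : HasDerivAt y v t) :
    HasDerivAt (fun s => xiSq d (y s)) (2 * (v ⬝ᵥ _root_.inertiaInv d (y t))) t :=
  (hy.vec_dotProduct (hy.inertiaInv d)).congr_deriv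
    (by rw [dotProduct_inertiaInv_comm d (y t) v, two_mul])

/-- The differential of `nOne`. -/
def nOneDiff (d Ω u ξ v ξ' v' : Vec3) : ℝ :=
  u ⬝ᵥ ξ' + Ω ⬝ᵥ v' + (gyroDiff d Ω u ⬝ᵥ inertiaInv d ξ + gyro d Ω ⬝ᵥ inertiaInv d v)

theorem HasDerivAt.nOne {x y y' : ℝ → Vec3} {u v v' : Vec3} {t : ℝ} (d : Vec3)
    (hx : HasDerivAt x u t) (hy : HasDerivAt y v t) (hy' : HasDerivAt y' v' t) :
    HasDerivAt (fun s => nOne d (x s) (y s) (y' s)) (nOneDiff d (x t) u (y t) v (y' t) v') t :=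
  (hx.vec_dotProduct hy').add ((hx.gyro d).vec_dotProduct (hy.inertiaInv d))

/-- The differential of `suslovQ` at `(Ω, Ω', ξ, ξ')` applied to `(u, u', v, v')`. -/
def suslovQDiff (d Ω u Ω' u' ξ v ξ' v' : Vec3) : Vec3 :=
  (2 * (v ⬝ᵥ inertiaInv d ξ)) • (inertia d Ω' - gyro d Ω)
    + xiSq d ξ • (inertia d u' - gyroDiff d Ω u)
    + nOneDiff d Ω u ξ v ξ' v' • ξ + nOne d Ω ξ ξ' • v

theorem HasDerivAt.suslovQ {x x' y y' : ℝ → Vec3} {u u' v v' : Vec3} {t : ℝ} (d : Vec3)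
    (hx : HasDerivAt x u t) (hx' : HasDerivAt x' u' t)
    (hy : HasDerivAt y v t) (hy' : HasDerivAt y' v' t) :
    HasDerivAt (fun s => suslovQ d (x s) (x' s) (y s) (y' s))
      (suslovQDiff d (x t) u (x' t) u' (y t) v (y' t) v') t :=
  (((hy.xiSq d).fun_smul ((hx'.inertia d).fun_sub (hx.gyro d))).fun_add
    ((hx.nOne d hy hy').fun_smul hy)).congr_deriv (by simp only [suslovQDiff]; abel)

/-! ### Coordinates -/

theorem cross_apply_zero (x y : Vec3) : (x ⨯₃ y) 0 = x 1 * y 2 - x 2 * y 1 := rfl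
theorem cross_apply_one (x y : Vec3) : (x ⨯₃ y) 1 = x 2 * y 0 - x 0 * y 2 := rfl
theorem cross_apply_two (x y : Vec3) : (x ⨯₃ y) 2 = x 0 * y 1 - x 1 * y 0 := rfl
theorem inertia_apply (d x : Vec3) (i : Fin 3) : inertia d x i = d i * x i := rfl
theorem inertiaInv_apply (d x : Vec3) (i : Fin 3) : inertiaInv d x i = (d i)⁻¹ * x i := rfl

/-! ### The transposed differential of the equations of motion -/

/-- `(∂q/∂Ω)ᵀ κ` -/
def adjOmega (d κ Ω ξ ξ' : Vec3) : Vec3 :=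
  -(xiSq d ξ • (inertia d (Ω ⨯₃ κ) + κ ⨯₃ (inertia d Ω)))
    + (κ ⬝ᵥ ξ) • (ξ' + inertia d (Ω ⨯₃ (inertiaInv d ξ)) + (inertiaInv d ξ) ⨯₃ (inertia d Ω))

/-- `(∂q/∂ξ)ᵀ κ` -/
def adjXi (d κ Ω Ω' ξ ξ' : Vec3) : Vec3 :=
  (2 * (κ ⬝ᵥ (inertia d Ω' - gyro d Ω))) • inertiaInv d ξ + nOne d Ω ξ ξ' • κ
    + (κ ⬝ᵥ ξ) • inertiaInv d (gyro d Ω)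

/-- The coefficients of `u'` and `v'` are the parts of the momenta `P` and `Q` that come from the
constraint; those of `u` and `v` are the constraint forces. Both the first variation and the
gradients of `H` rest on this identity. -/
theorem dotProduct_suslovQDiff (d κ Ω u Ω' u' ξ v ξ' v' : Vec3) :
    κ ⬝ᵥ suslovQDiff d Ω u Ω' u' ξ v ξ' v' =
      u ⬝ᵥ adjOmega d κ Ω ξ ξ' + u' ⬝ᵥ (xiSq d ξ • inertia d κ)
        + v ⬝ᵥ adjXi d κ Ω Ω' ξ ξ' + v' ⬝ᵥ ((κ ⬝ᵥ ξ) • Ω) := by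
  simp only [suslovQDiff, adjOmega, adjXi, gyroDiff, nOneDiff, nOne, gyro, dotProduct,
    Fin.sum_univ_three, cross_apply_zero, cross_apply_one, cross_apply_two, xiSq, inertia_apply,
    inertiaInv_apply, Pi.add_apply, Pi.sub_apply, Pi.neg_apply, Pi.smul_apply, smul_eq_mul]
  ring

/-! ### Positivity of the inertia form and solving the equations of motion for `Ω̇`. -/

theorem inertiaInv_inertia {d : Vec3} (hd : ∀ i, 0 < d i) (x : Vec3) :
    inertiaInv d (inertia d x) = x :=
  funext fun i => inv_mul_cancel_left₀ (hd i).ne' (x i)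

theorem inertia_inertiaInv {d : Vec3} (hd : ∀ i, 0 < d i) (x : Vec3) :
    inertia d (inertiaInv d x) = x :=
  funext fun i => mul_inv_cancel_left₀ (hd i).ne' (x i)

theorem inertiaInv_smul (d x : Vec3) (c : ℝ) : inertiaInv d (c • x) = c • inertiaInv d x :=
  funext fun i => mul_left_comm (d i)⁻¹ c (x i)

theorem inertia_smul (d x : Vec3) (c : ℝ) : inertia d (c • x) = c • inertia d x :=
  funext fun i => mul_left_comm (d i) c (x i)

theorem xiSq_eq_sum (d ξ : Vec3) : xiSq d ξ = ∑ i, (d i)⁻¹ * (ξ i * ξ i) := by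
  simp only [xiSq, dotProduct, inertiaInv_apply, mul_left_comm]

theorem xiSq_nonneg {d : Vec3} (hd : ∀ i, 0 < d i) (ξ : Vec3) : 0 ≤ xiSq d ξ := by
  rw [xiSq_eq_sum]
  exact Finset.sum_nonneg fun i _ => mul_nonneg (inv_pos.2 (hd i)).le (mul_self_nonneg (ξ i))

theorem xiSq_pos {d : Vec3} (hd : ∀ i, 0 < d i) {ξ : Vec3} (h : ξ ≠ 0) : 0 < xiSq d ξ := by
  obtain ⟨i, hi⟩ := Function.ne_iff.1 h
  rw [xiSq_eq_sum]
  exact Finset.sum_pos' (fun j _ => mul_nonneg (inv_pos.2 (hd j)).le (mul_self_nonneg (ξ j)))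
    ⟨i, Finset.mem_univ i, mul_pos (inv_pos.2 (hd i)) (mul_self_pos.2 hi)⟩

/-- `x = s⁻¹ 𝕀⁻¹ y` solves `s 𝕀 x = y`. -/
theorem eq_inv_smul_inertiaInv_iff {d : Vec3} (hd : ∀ i, 0 < d i) {s : ℝ} (hs : s ≠ 0)
    {x y : Vec3} : x = s⁻¹ • inertiaInv d y ↔ s • inertia d x = y := by
  constructor
  · rintro rfl
    rw [← inertia_smul, smul_inv_smul₀ hs, inertia_inertiaInv hd]
  · rintro rfl
    rw [inertiaInv_smul, inertiaInv_inertia hd, inv_smul_smul₀ hs]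

theorem eq_omegaDot_iff {d : Vec3} (hd : ∀ i, 0 < d i) {Ω Ω' ξ ξ' : Vec3} (hξ : ξ ≠ 0) :
    Ω' = omegaDot d Ω ξ ξ' ↔ suslovQ d Ω Ω' ξ ξ' = 0 := by
  rw [omegaDot, eq_inv_smul_inertiaInv_iff hd (xiSq_pos hd hξ).ne', suslovQ, smul_sub,
    eq_sub_iff_add_eq, ← sub_eq_zero]
  constructor <;> intro h <;> rw [← h] <;> abel

theorem suslovQ_omegaDot {d : Vec3} (hd : ∀ i, 0 < d i) {Ω ξ : Vec3} (hξ : ξ ≠ 0) (ξ' : Vec3) :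
    suslovQ d Ω (omegaDot d Ω ξ ξ') ξ ξ' = 0 := (eq_omegaDot_iff hd hξ).1 rfl

/-! ### Continuity and differentiability of the coefficients -/

theorem continuous_inertia (d : Vec3) : Continuous (inertia d) :=
  continuous_pi fun i => (continuous_apply i).const_smul (d i)

theorem continuous_inertiaInv (d : Vec3) : Continuous (inertiaInv d) :=
  continuous_pi fun i => (continuous_apply i).const_smul (d i)⁻¹

theorem Continuous.cross {X : Type*} [TopologicalSpace X] {f g : X → Vec3} (hf : Continuous f)
    (hg : Continuous g) : Continuous fun x => f x ⨯₃ g x := by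
  have h : ∀ i j, Continuous fun x => f x i * g x j - f x j * g x i := by fun_prop
  refine continuous_pi fun i => ?_
  fin_cases i
  exacts [h 1 2, h 2 0, h 0 1]

section
variable {X : Type*} [TopologicalSpace X] {x x' y y' z : X → Vec3} (d : Vec3)

theorem Continuous.inertia (hx : Continuous x) : Continuous fun s => inertia d (x s) :=
  (continuous_inertia d).comp hx

theorem Continuous.inertiaInv (hx : Continuous x) : Continuous fun s => inertiaInv d (x s) :=
  (continuous_inertiaInv d).comp hx

theorem Continuous.gyro (hx : Continuous x) : Continuous fun s => gyro d (x s) :=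
  (hx.inertia d).cross hx

theorem Continuous.xiSq (hx : Continuous x) : Continuous fun s => xiSq d (x s) :=
  hx.dotProduct (hx.inertiaInv d)

theorem Continuous.nOne (hx : Continuous x) (hy : Continuous y) (hy' : Continuous y') :
    Continuous fun s => nOne d (x s) (y s) (y' s) :=
  (hx.dotProduct hy').add ((hx.gyro d).dotProduct (hy.inertiaInv d))

theorem Continuous.suslovQ (hx : Continuous x) (hx' : Continuous x') (hy : Continuous y)
    (hy' : Continuous y') : Continuous fun s => suslovQ d (x s) (x' s) (y s) (y' s) :=
  ((hy.xiSq d).smul ((hx'.inertia d).sub (hx.gyro d))).add ((hx.nOne d hy hy').smul hy)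

theorem Continuous.adjOmega (hz : Continuous z) (hx : Continuous x) (hy : Continuous y)
    (hy' : Continuous y') : Continuous fun s => adjOmega d (z s) (x s) (y s) (y' s) :=
  ((hy.xiSq d).smul (((hx.cross hz).inertia d).add (hz.cross (hx.inertia d)))).neg.add
    ((hz.dotProduct hy).smul ((hy'.add ((hx.cross (hy.inertiaInv d)).inertia d)).add
      ((hy.inertiaInv d).cross (hx.inertia d))))

theorem Continuous.adjXi (hz : Continuous z) (hx : Continuous x) (hx' : Continuous x')
    (hy : Continuous y) (hy' : Continuous y') :
    Continuous fun s => adjXi d (z s) (x s) (x' s) (y s) (y' s) :=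
  (((continuous_const.mul (hz.dotProduct ((hx'.inertia d).sub (hx.gyro d)))).smul
    (hy.inertiaInv d)).add ((hx.nOne d hy hy').smul hz)).add
    ((hz.dotProduct hy).smul ((hx.gyro d).inertiaInv d))

end

/-! ### Gradients of the cost -/

theorem HasFDerivAt.dotProduct_vgrad {f : Vec3 → ℝ} {L : Vec3 →L[ℝ] ℝ} {x : Vec3}
    (h : HasFDerivAt f L x) (u : Vec3) : u ⬝ᵥ vgrad f x = L u := by
  have := L.toLinearMap.pi_apply_eq_sum_univ u
  simp only [ContinuousLinearMap.coe_coe, smul_eq_mul] at this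
  rw [this]
  simp only [vgrad, h.fderiv, dotProduct]
  refine Finset.sum_congr rfl fun i _ => ?_
  congr 3
  ext j
  simp [Pi.single_apply, eq_comm]

theorem eq_of_forall_dotProduct {x y : Vec3} (h : ∀ u : Vec3, u ⬝ᵥ x = u ⬝ᵥ y) : x = y :=
  funext fun i => by simpa using h (Pi.single i 1)

/-- The gradient from directional derivatives. -/
theorem vgrad_eq {f : Vec3 → ℝ} {x w : Vec3} (hf : DifferentiableAt ℝ f x)
    (h : ∀ u : Vec3, HasDerivAt (fun s : ℝ => f (x + s • u)) (u ⬝ᵥ w) 0) : vgrad f x = w := by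
  refine eq_of_forall_dotProduct fun u => ?_
  rw [hf.hasFDerivAt.dotProduct_vgrad u]
  have hl : HasDerivAt (fun s : ℝ => x + s • u) u 0 := by
    simpa using ((hasDerivAt_id (0 : ℝ)).smul_const u).const_add x
  have hf' : HasFDerivAt f (fderiv ℝ f x) (x + (0 : ℝ) • u) := by simpa using hf.hasFDerivAt
  exact (hf'.comp_hasDerivAt (0 : ℝ) hl).unique (h u)

section
variable {C : CostFn}

/-- The cost at time `t` as a function on the product space. -/
abbrev costAt (C : CostFn) (t : ℝ) : Vec3 × Vec3 × Vec3 × Vec3 → ℝ :=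
  fun z => C z.1 z.2.1 z.2.2.1 z.2.2.2 t

theorem dotProduct_gradOmega {x x' y y' : Vec3} {t : ℝ}
    (hC : DifferentiableAt ℝ (costAt C t) (x, x', y, y')) (u : Vec3) :
    u ⬝ᵥ gradOmega C x x' y y' t = fderiv ℝ (costAt C t) (x, x', y, y') (u, 0, 0, 0) :=
  (HasFDerivAt.comp (f := fun z => (z, x', y, y')) x hC.hasFDerivAt
    ((hasFDerivAt_id x).prodMk (hasFDerivAt_const _ x))).dotProduct_vgrad u

theorem dotProduct_gradOmegaDot {x x' y y' : Vec3} {t : ℝ}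
    (hC : DifferentiableAt ℝ (costAt C t) (x, x', y, y')) (u : Vec3) :
    u ⬝ᵥ gradOmegaDot C x x' y y' t = fderiv ℝ (costAt C t) (x, x', y, y') (0, u, 0, 0) :=
  (HasFDerivAt.comp (f := fun z => (x, z, y, y')) x' hC.hasFDerivAt
    ((hasFDerivAt_const _ x').prodMk
      ((hasFDerivAt_id x').prodMk (hasFDerivAt_const _ x')))).dotProduct_vgrad u

theorem dotProduct_gradXi {x x' y y' : Vec3} {t : ℝ}
    (hC : DifferentiableAt ℝ (costAt C t) (x, x', y, y')) (u : Vec3) :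
    u ⬝ᵥ gradXi C x x' y y' t = fderiv ℝ (costAt C t) (x, x', y, y') (0, 0, u, 0) :=
  (HasFDerivAt.comp (f := fun z => (x, x', z, y')) y hC.hasFDerivAt
    ((hasFDerivAt_const _ y).prodMk ((hasFDerivAt_const _ y).prodMk
      ((hasFDerivAt_id y).prodMk (hasFDerivAt_const _ y))))).dotProduct_vgrad u

theorem dotProduct_gradXiDot {x x' y y' : Vec3} {t : ℝ}
    (hC : DifferentiableAt ℝ (costAt C t) (x, x', y, y')) (u : Vec3) :
    u ⬝ᵥ gradXiDot C x x' y y' t = fderiv ℝ (costAt C t) (x, x', y, y') (0, 0, 0, u) :=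
  (HasFDerivAt.comp (f := fun z => (x, x', y, z)) y' hC.hasFDerivAt
    ((hasFDerivAt_const _ y').prodMk ((hasFDerivAt_const _ y').prodMk
      ((hasFDerivAt_const _ y').prodMk (hasFDerivAt_id y'))))).dotProduct_vgrad u

/-- The chain rule for the cost along a curve at fixed time, in terms of the gradients. -/
theorem hasDerivAt_cost {x x' y y' : ℝ → Vec3} {u u' v v' : Vec3} {s t : ℝ}
    (hC : DifferentiableAt ℝ (costAt C t) (x s, x' s, y s, y' s))
    (hx : HasDerivAt x u s) (hx' : HasDerivAt x' u' s)
    (hy : HasDerivAt y v s) (hy' : HasDerivAt y' v' s) :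
    HasDerivAt (fun e => C (x e) (x' e) (y e) (y' e) t)
      (u ⬝ᵥ gradOmega C (x s) (x' s) (y s) (y' s) t
        + u' ⬝ᵥ gradOmegaDot C (x s) (x' s) (y s) (y' s) t
        + v ⬝ᵥ gradXi C (x s) (x' s) (y s) (y' s) t
        + v' ⬝ᵥ gradXiDot C (x s) (x' s) (y s) (y' s) t) s := by
  have h := hC.hasFDerivAt.comp_hasDerivAt s (hx.prodMk (hx'.prodMk (hy.prodMk hy')))
  refine h.congr_deriv ?_
  rw [dotProduct_gradOmega hC, dotProduct_gradOmegaDot hC, dotProduct_gradXi hC,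
    dotProduct_gradXiDot hC, ← map_add, ← map_add, ← map_add]
  simp

variable {X : Type*} [TopologicalSpace X] {x x' y y' : X → Vec3} {t : X → ℝ}

theorem IsRegularCost.continuous_comp (hC : IsRegularCost C) (hx : Continuous x)
    (hx' : Continuous x') (hy : Continuous y) (hy' : Continuous y') (ht : Continuous t) :
    Continuous fun s => C (x s) (x' s) (y s) (y' s) (t s) :=
  hC.continuous.comp ((hx.prodMk (hx'.prodMk (hy.prodMk hy'))).prodMk ht)

theorem IsRegularCost.continuous_gradOmega (hC : IsRegularCost C) (hx : Continuous x)
    (hx' : Continuous x') (hy : Continuous y) (hy' : Continuous y') (ht : Continuous t) :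
    Continuous fun s => gradOmega C (x s) (x' s) (y s) (y' s) (t s) := by
  refine continuous_pi fun i => ?_
  have h := (hC.continuous_fderiv.comp ((hx.prodMk (hx'.prodMk (hy.prodMk hy'))).prodMk ht)).clm_apply
    (continuous_const (y := ((Pi.single i 1 : Vec3), (0 : Vec3), (0 : Vec3), (0 : Vec3))))
  refine h.congr fun s => ?_
  simpa using (dotProduct_gradOmega (hC.differentiable (t s) _) (Pi.single i 1)).symm

theorem IsRegularCost.continuous_gradXi (hC : IsRegularCost C) (hx : Continuous x)
    (hx' : Continuous x') (hy : Continuous y) (hy' : Continuous y') (ht : Continuous t) :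
    Continuous fun s => gradXi C (x s) (x' s) (y s) (y' s) (t s) := by
  refine continuous_pi fun i => ?_
  have h := (hC.continuous_fderiv.comp ((hx.prodMk (hx'.prodMk (hy.prodMk hy'))).prodMk ht)).clm_apply
    (continuous_const (y := ((0 : Vec3), (0 : Vec3), (Pi.single i 1 : Vec3), (0 : Vec3))))
  refine h.congr fun s => ?_
  simpa using (dotProduct_gradXi (hC.differentiable (t s) _) (Pi.single i 1)).symm

theorem IsRegularCost.continuous_gradOmegaDot (hC : IsRegularCost C) (hx : Continuous x)
    (hx' : Continuous x') (hy : Continuous y) (hy' : Continuous y') (ht : Continuous t) :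
    Continuous fun s => gradOmegaDot C (x s) (x' s) (y s) (y' s) (t s) :=
  hC.differentiable_gradOmegaDot.continuous.comp
    ((hx.prodMk (hx'.prodMk (hy.prodMk hy'))).prodMk ht)

theorem IsRegularCost.continuous_gradXiDot (hC : IsRegularCost C) (hx : Continuous x)
    (hx' : Continuous x') (hy : Continuous y) (hy' : Continuous y') (ht : Continuous t) :
    Continuous fun s => gradXiDot C (x s) (x' s) (y s) (y' s) (t s) :=
  hC.differentiable_gradXiDot.continuous.comp
    ((hx.prodMk (hx'.prodMk (hy.prodMk hy'))).prodMk ht)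

end

section
variable {C : CostFn} {Ω ξ : ℝ → Vec3}

theorem IsRegularCost.differentiable_along_gradOmegaDot (hC : IsRegularCost C)
    (hΩ : TwiceDifferentiable Ω) (hξ : TwiceDifferentiable ξ) :
    Differentiable ℝ (along (gradOmegaDot C) Ω ξ) :=
  hC.differentiable_gradOmegaDot.comp
    ((hΩ.1.prodMk (hΩ.2.prodMk (hξ.1.prodMk hξ.2))).prodMk differentiable_id)

theorem IsRegularCost.differentiable_along_gradXiDot (hC : IsRegularCost C)
    (hΩ : TwiceDifferentiable Ω) (hξ : TwiceDifferentiable ξ) :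
    Differentiable ℝ (along (gradXiDot C) Ω ξ) :=
  hC.differentiable_gradXiDot.comp
    ((hΩ.1.prodMk (hΩ.2.prodMk (hξ.1.prodMk hξ.2))).prodMk differentiable_id)

end

/-! ### The Euler-Lagrange equations -/

/-- The gradient with respect to `Ω` of the integrand `C + ⟨κ, q⟩` along a trajectory. -/
def forceOmega (d : Vec3) (C : CostFn) (κ Ω ξ : ℝ → Vec3) (t : ℝ) : Vec3 :=
  along (gradOmega C) Ω ξ t + adjOmega d (κ t) (Ω t) (ξ t) (deriv ξ t)

/-- The gradient with respect to `ξ` of the integrand `C + ⟨κ, q⟩` along a trajectory. -/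
def forceXi (d : Vec3) (C : CostFn) (κ Ω ξ : ℝ → Vec3) (t : ℝ) : Vec3 :=
  along (gradXi C) Ω ξ t + adjXi d (κ t) (Ω t) (deriv Ω t) (ξ t) (deriv ξ t)

/-- The boundary value problem of the calculus of variations for the integrand `C + ⟨κ, q⟩`. -/
structure EulerLagrange (d : Vec3) (C : CostFn) (a b : ℝ) (Ωa Ωb : Vec3)
    (freeTime : Prop) (κ Ω ξ : ℝ → Vec3) : Prop where
  motion : ∀ t ∈ Icc a b, suslovQ d (Ω t) (deriv Ω t) (ξ t) (deriv ξ t) = 0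
  omega_eq : ∀ t ∈ Icc a b, deriv (momOmega d C κ Ω ξ) t = forceOmega d C κ Ω ξ t
  xi_eq : ∀ t ∈ Icc a b, deriv (momXi C κ Ω ξ) t = forceXi d C κ Ω ξ t
  left_omega : Ω a = Ωa
  left_xi : momXi C κ Ω ξ a = 0
  right_omega : Ω b = Ωb
  right_xi : momXi C κ Ω ξ b = 0
  right_time : freeTime → along C Ω ξ b - momOmega d C κ Ω ξ b ⬝ᵥ deriv Ω b = 0

section
variable {d : Vec3} {C : CostFn} {a b : ℝ} {Ωa Ωb : Vec3} {freeTime : Prop}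
  {κ Ω ξ δκ δΩ δξ : ℝ → Vec3} {ρ ν dρ dν : Vec3} {db : ℝ}

theorem hasDerivAt_momOmega (hC : IsRegularCost C) (hκ : Differentiable ℝ κ)
    (hΩ : TwiceDifferentiable Ω) (hξ : TwiceDifferentiable ξ) (t : ℝ) :
    HasDerivAt (momOmega d C κ Ω ξ)
      (xiSq d (ξ t) • inertia d (deriv κ t)
        + (2 * (deriv ξ t ⬝ᵥ inertiaInv d (ξ t))) • inertia d (κ t)
        + deriv (along (gradOmegaDot C) Ω ξ) t) t :=
  (((hξ.1 t).hasDerivAt.xiSq d).fun_smul ((hκ t).hasDerivAt.inertia d)).fun_add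
    (hC.differentiable_along_gradOmegaDot hΩ hξ t).hasDerivAt

theorem hasDerivAt_momXi (hC : IsRegularCost C) (hκ : Differentiable ℝ κ)
    (hΩ : TwiceDifferentiable Ω) (hξ : TwiceDifferentiable ξ) (t : ℝ) :
    HasDerivAt (momXi C κ Ω ξ)
      ((κ t ⬝ᵥ ξ t) • deriv Ω t + (deriv κ t ⬝ᵥ ξ t + κ t ⬝ᵥ deriv ξ t) • Ω t
        + deriv (along (gradXiDot C) Ω ξ) t) t :=
  (((hκ t).hasDerivAt.vec_dotProduct (hξ.1 t).hasDerivAt).fun_smul (hΩ.1 t).hasDerivAt).fun_add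
    (hC.differentiable_along_gradXiDot hΩ hξ t).hasDerivAt

theorem continuous_forceOmega (hC : IsRegularCost C) (hκ : Differentiable ℝ κ)
    (hΩ : TwiceDifferentiable Ω) (hξ : TwiceDifferentiable ξ) :
    Continuous (forceOmega d C κ Ω ξ) :=
  (hC.continuous_gradOmega hΩ.1.continuous hΩ.2.continuous hξ.1.continuous hξ.2.continuous
    continuous_id).add
    (Continuous.adjOmega d hκ.continuous hΩ.1.continuous hξ.1.continuous hξ.2.continuous)

theorem continuous_forceXi (hC : IsRegularCost C) (hκ : Differentiable ℝ κ)
    (hΩ : TwiceDifferentiable Ω) (hξ : TwiceDifferentiable ξ) :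
    Continuous (forceXi d C κ Ω ξ) :=
  (hC.continuous_gradXi hΩ.1.continuous hΩ.2.continuous hξ.1.continuous hξ.2.continuous
    continuous_id).add
    (Continuous.adjXi d hκ.continuous hΩ.1.continuous hΩ.2.continuous hξ.1.continuous
      hξ.2.continuous)

/-- The gradient of the integrand, evaluated on a variation, as a function of the values of the
trajectory. -/
def lagrangianDiff (d : Vec3) (C : CostFn) (k dk x dx x' dx' y dy y' dy' : Vec3) (t : ℝ) : ℝ :=
  dk ⬝ᵥ suslovQ d x x' y y'
    + (dx ⬝ᵥ (gradOmega C x x' y y' t + adjOmega d k x y y')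
      + dx' ⬝ᵥ (xiSq d y • inertia d k + gradOmegaDot C x x' y y' t))
    + (dy ⬝ᵥ (gradXi C x x' y y' t + adjXi d k x x' y y')
      + dy' ⬝ᵥ ((k ⬝ᵥ y) • x + gradXiDot C x x' y y' t))

theorem hasDerivAt_lagrangian {k x x' y y' : ℝ → Vec3} {dk u u' v v' : Vec3} {s t : ℝ}
    (hC : IsRegularCost C) (hk : HasDerivAt k dk s)
    (hx : HasDerivAt x u s) (hx' : HasDerivAt x' u' s)
    (hy : HasDerivAt y v s) (hy' : HasDerivAt y' v' s) :
    HasDerivAt (fun e => C (x e) (x' e) (y e) (y' e) t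
        + k e ⬝ᵥ suslovQ d (x e) (x' e) (y e) (y' e))
      (lagrangianDiff d C (k s) dk (x s) u (x' s) u' (y s) v (y' s) v' t) s := by
  refine ((hasDerivAt_cost (hC.differentiable t _) hx hx' hy hy').fun_add
    (hk.vec_dotProduct (hx.suslovQ d hx' hy hy'))).congr_deriv ?_
  rw [dotProduct_suslovQDiff]
  simp only [lagrangianDiff, dotProduct_add]
  ring

theorem hasDerivAt_add_smul {E : Type*} [NormedAddCommGroup E] [NormedSpace ℝ E] (x u : E) (s : ℝ) :
    HasDerivAt (fun e : ℝ => x + e • u) u s := by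
  simpa using ((hasDerivAt_id s).smul_const u).const_add x

theorem deriv_add_smul {x u : ℝ → Vec3} (hx : Differentiable ℝ x) (hu : Differentiable ℝ u)
    (e t : ℝ) : deriv (x + e • u) t = deriv x t + e • deriv u t :=
  ((hx t).hasDerivAt.add ((hu t).hasDerivAt.const_smul e)).deriv

/-- The first variation of the performance index. -/
theorem hasDerivAt_performanceIndex (hC : IsRegularCost C) (hκ : Differentiable ℝ κ)
    (hΩ : TwiceDifferentiable Ω) (hξ : TwiceDifferentiable ξ) (hδκ : Differentiable ℝ δκ)
    (hδΩ : TwiceDifferentiable δΩ) (hδξ : TwiceDifferentiable δξ) (hδa : δΩ a = 0) :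
    HasDerivAt (fun ε : ℝ => performanceIndex d C a Ωa Ωb
      (κ + ε • δκ) (Ω + ε • δΩ) (ξ + ε • δξ) (ρ + ε • dρ) (ν + ε • dν) (b + ε * db))
      (dρ ⬝ᵥ (Ω a - Ωa) + (dν ⬝ᵥ (Ω b - Ωb) + ν ⬝ᵥ (db • deriv Ω b + δΩ b))
        + ((∫ t in a..b, (δκ t ⬝ᵥ suslovQ d (Ω t) (deriv Ω t) (ξ t) (deriv ξ t)
            + (δΩ t ⬝ᵥ forceOmega d C κ Ω ξ t + deriv δΩ t ⬝ᵥ momOmega d C κ Ω ξ t)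
            + (δξ t ⬝ᵥ forceXi d C κ Ω ξ t + deriv δξ t ⬝ᵥ momXi C κ Ω ξ t)))
          + db * (along C Ω ξ b
            + κ b ⬝ᵥ suslovQ d (Ω b) (deriv Ω b) (ξ b) (deriv ξ b)))) 0 := by
  have h1 : HasDerivAt (fun ε : ℝ => (ρ + ε • dρ) ⬝ᵥ ((Ω + ε • δΩ) a - Ωa))
      (dρ ⬝ᵥ (Ω a - Ωa)) 0 := by
    have := (hasDerivAt_add_smul ρ dρ 0).vec_dotProduct (hasDerivAt_const (0 : ℝ) (Ω a - Ωa))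
    simpa [hδa] using this
  have h2 : HasDerivAt (fun ε : ℝ => (ν + ε • dν) ⬝ᵥ ((Ω + ε • δΩ) (b + ε * db) - Ωb))
      (dν ⬝ᵥ (Ω b - Ωb) + ν ⬝ᵥ (db • deriv Ω b + δΩ b)) 0 := by
    have hl : HasDerivAt (fun ε : ℝ => b + ε * db) db 0 := hasDerivAt_add_smul b db 0
    have hb : b + 0 * db = b := by ring
    have e1 : HasDerivAt (fun ε : ℝ => Ω (b + ε * db)) (db • deriv Ω b) 0 :=
      HasDerivAt.scomp (h := fun ε : ℝ => b + ε * db) 0 (by rw [hb]; exact (hΩ.1 b).hasDerivAt) hl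
    have e2 : HasDerivAt (fun ε : ℝ => δΩ (b + ε * db)) (db • deriv δΩ b) 0 :=
      HasDerivAt.scomp (h := fun ε : ℝ => b + ε * db) 0 (by rw [hb]; exact (hδΩ.1 b).hasDerivAt) hl
    -- At `ε = 0` the product rule for `ε δΩ(b + ε db)` leaves only `δΩ b`; the term with the
    -- derivative of `δΩ` is of second order.
    have e3 := (e1.fun_add ((hasDerivAt_id (0 : ℝ)).fun_smul e2)).sub_const Ωb
    have := (hasDerivAt_add_smul ν dν 0).vec_dotProduct e3
    simpa using this
  have h3 := hasDerivAt_integral_moving_endpoint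
    (F := fun ε t => C (Ω t + ε • δΩ t) (deriv Ω t + ε • deriv δΩ t) (ξ t + ε • δξ t)
        (deriv ξ t + ε • deriv δξ t) t
      + (κ t + ε • δκ t) ⬝ᵥ suslovQ d (Ω t + ε • δΩ t) (deriv Ω t + ε • deriv δΩ t)
        (ξ t + ε • δξ t) (deriv ξ t + ε • deriv δξ t))
    (F' := fun ε t => lagrangianDiff d C (κ t + ε • δκ t) (δκ t) (Ω t + ε • δΩ t) (δΩ t)
        (deriv Ω t + ε • deriv δΩ t) (deriv δΩ t) (ξ t + ε • δξ t) (δξ t)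
        (deriv ξ t + ε • deriv δξ t) (deriv δξ t) t)
    ?_ ?_ (fun ε t => hasDerivAt_lagrangian hC (hasDerivAt_add_smul _ _ ε)
      (hasDerivAt_add_smul _ _ ε) (hasDerivAt_add_smul _ _ ε) (hasDerivAt_add_smul _ _ ε)
      (hasDerivAt_add_smul _ _ ε)) a b db
  · refine ((h1.fun_add h2).fun_add h3).congr_of_eventuallyEq (Eventually.of_forall fun ε => ?_)
      |>.congr_deriv ?_
    · simp only [performanceIndex, along, deriv_add_smul hΩ.1 hδΩ.1, deriv_add_smul hξ.1 hδξ.1]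
      rfl
    · simp only [zero_smul, add_zero]
      rfl
  all_goals
    have cκ := hκ.continuous
    have cδκ := hδκ.continuous
    have cΩ := hΩ.1.continuous
    have cΩ' := hΩ.2.continuous
    have cξ := hξ.1.continuous
    have cξ' := hξ.2.continuous
    have cδΩ := hδΩ.1.continuous
    have cδΩ' := hδΩ.2.continuous
    have cδξ := hδξ.1.continuous
    have cδξ' := hδξ.2.continuous
    have k1 : Continuous fun p : ℝ × ℝ => κ p.2 + p.1 • δκ p.2 := by fun_prop
    have k2 : Continuous fun p : ℝ × ℝ => Ω p.2 + p.1 • δΩ p.2 := by fun_prop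
    have k3 : Continuous fun p : ℝ × ℝ => deriv Ω p.2 + p.1 • deriv δΩ p.2 := by fun_prop
    have k4 : Continuous fun p : ℝ × ℝ => ξ p.2 + p.1 • δξ p.2 := by fun_prop
    have k5 : Continuous fun p : ℝ × ℝ => deriv ξ p.2 + p.1 • deriv δξ p.2 := by fun_prop
  · exact (hC.continuous_comp k2 k3 k4 k5 continuous_snd).add
      (k1.dotProduct (Continuous.suslovQ d k2 k3 k4 k5))
  · refine (((cδκ.comp continuous_snd).dotProduct (Continuous.suslovQ d k2 k3 k4 k5)).add
      (((cδΩ.comp continuous_snd).dotProduct ?_).add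
        ((cδΩ'.comp continuous_snd).dotProduct ?_))).add
      (((cδξ.comp continuous_snd).dotProduct ?_).add ((cδξ'.comp continuous_snd).dotProduct ?_))
    · exact (hC.continuous_gradOmega k2 k3 k4 k5 continuous_snd).add
        (Continuous.adjOmega d k1 k2 k4 k5)
    · exact ((Continuous.xiSq d k4).smul (Continuous.inertia d k1)).add
        (hC.continuous_gradOmegaDot k2 k3 k4 k5 continuous_snd)
    · exact (hC.continuous_gradXi k2 k3 k4 k5 continuous_snd).add
        (Continuous.adjXi d k1 k2 k3 k4 k5)
    · exact ((k1.dotProduct k4).smul k2).add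
        (hC.continuous_gradXiDot k2 k3 k4 k5 continuous_snd)

end

/-! ### Stationarity, Euler-Lagrange equations and the boundary value problem. -/

section
variable {d : Vec3} {C : CostFn} {a b : ℝ} {Ωa Ωb : Vec3} {freeTime : Prop}
  {κ Ω ξ : ℝ → Vec3} {ρ ν : Vec3}

theorem twiceDifferentiable_zero : TwiceDifferentiable (0 : ℝ → Vec3) :=
  ⟨differentiable_const 0, by rw [deriv_zero]; exact differentiable_const 0⟩

theorem differentiable_suslovQ (hΩ : TwiceDifferentiable Ω) (hξ : TwiceDifferentiable ξ) :
    Differentiable ℝ fun t => suslovQ d (Ω t) (deriv Ω t) (ξ t) (deriv ξ t) := fun t =>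
  ((hΩ.1 t).hasDerivAt.suslovQ d (hΩ.2 t).hasDerivAt (hξ.1 t).hasDerivAt
    (hξ.2 t).hasDerivAt).differentiableAt

theorem differentiable_momOmega (hC : IsRegularCost C) (hκ : Differentiable ℝ κ)
    (hΩ : TwiceDifferentiable Ω) (hξ : TwiceDifferentiable ξ) :
    Differentiable ℝ (momOmega d C κ Ω ξ) :=
  fun t => (hasDerivAt_momOmega hC hκ hΩ hξ t).differentiableAt

theorem differentiable_momXi (hC : IsRegularCost C) (hκ : Differentiable ℝ κ)
    (hΩ : TwiceDifferentiable Ω) (hξ : TwiceDifferentiable ξ) :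
    Differentiable ℝ (momXi C κ Ω ξ) :=
  fun t => (hasDerivAt_momXi hC hκ hΩ hξ t).differentiableAt

/-- For a feasible trajectory, the vanishing of the first variation with respect to the trajectory
and the terminal time gives the Euler-Lagrange equations. -/
theorem eulerLagrange_of_firstVariation (hab : a < b) (hC : IsRegularCost C)
    (hκ : Differentiable ℝ κ) (hΩ : TwiceDifferentiable Ω) (hξ : TwiceDifferentiable ξ)
    (hfeas : IsFeasible d a b Ωa Ωb Ω ξ)
    (h : ∀ (δΩ δξ : ℝ → Vec3) (db : ℝ), IsVariation a freeTime δΩ δξ db →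
      ν ⬝ᵥ (db • deriv Ω b + δΩ b)
        + ((∫ t in a..b, ((δΩ t ⬝ᵥ forceOmega d C κ Ω ξ t + deriv δΩ t ⬝ᵥ momOmega d C κ Ω ξ t)
            + (δξ t ⬝ᵥ forceXi d C κ Ω ξ t + deriv δξ t ⬝ᵥ momXi C κ Ω ξ t)))
          + db * along C Ω ξ b) = 0) :
    EulerLagrange d C a b Ωa Ωb freeTime κ Ω ξ ∧ ν = -momOmega d C κ Ω ξ b := by
  obtain ⟨h1, h2⟩ := du_bois_reymond (ν := ν) hab
    (differentiable_momOmega (d := d) hC hκ hΩ hξ) (continuous_forceOmega hC hκ hΩ hξ) fun x hx hxa => by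
      simpa [add_comm] using h x 0 0 ⟨hx, twiceDifferentiable_zero, hxa, fun _ => rfl⟩
  obtain ⟨h3, h4, h5⟩ := du_bois_reymond_free hab
    (differentiable_momXi hC hκ hΩ hξ) (continuous_forceXi (d := d) hC hκ hΩ hξ) fun x hx => by
      simpa using h 0 x 0 ⟨twiceDifferentiable_zero, hx, rfl, fun _ => rfl⟩
  refine ⟨⟨hfeas.motion, h1, h3, hfeas.left, h4, hfeas.right, h5, fun hfree => ?_⟩,
    by rw [h2, neg_neg]⟩
  -- Moving only the terminal time gives `⟨ν, Ω̇(b)⟩ + C = 0` at `b`, where `ν = -P(b)`.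
  have := h 0 0 1 ⟨twiceDifferentiable_zero, twiceDifferentiable_zero, rfl, fun hn => (hn hfree).elim⟩
  rw [h2, neg_dotProduct, sub_neg_eq_add, add_comm]
  simpa using this

/-- The variations `δκ`, `dρ`, `dν` recover the constraints, the others the Euler-Lagrange system.
As `δΩ(a) = 0`, the multiplier `ρ` stays undetermined. Conversely, integration by parts collapses
the integral to `⟨δΩ(b), P(b)⟩`, which cancels against `ν = -P(b)`. -/
theorem isStationaryIndex_iff_eulerLagrange (hab : a < b) (hC : IsRegularCost C)
    (hκ : Differentiable ℝ κ) (hΩ : TwiceDifferentiable Ω) (hξ : TwiceDifferentiable ξ) :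
    IsStationaryIndex d C a Ωa Ωb freeTime κ Ω ξ ρ ν b ↔
      EulerLagrange d C a b Ωa Ωb freeTime κ Ω ξ ∧ ν = -momOmega d C κ Ω ξ b := by
  constructor
  · intro h
    have h' := fun δκ δΩ δξ dρ dν db hδκ (hv : IsVariation a freeTime δΩ δξ db) =>
      (hasDerivAt_performanceIndex (d := d) (Ωa := Ωa) (Ωb := Ωb) (ρ := ρ) (ν := ν) (dρ := dρ)
        (dν := dν) (db := db) hC hκ hΩ hξ hδκ hv.omega hv.xi hv.left).unique
        (h δκ δΩ δξ dρ dν db hδκ hv)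
    have hz : IsVariation a freeTime 0 0 0 :=
      ⟨twiceDifferentiable_zero, twiceDifferentiable_zero, rfl, fun _ => rfl⟩
    have d0 : Differentiable ℝ (0 : ℝ → Vec3) := differentiable_const 0
    have hfeas : IsFeasible d a b Ωa Ωb Ω ξ := by
      refine ⟨?_, ?_, ?_⟩
      · refine eqOn_zero_of_integral_dotProduct_self hab
          (differentiable_suslovQ hΩ hξ).continuous ?_
        simpa using h' _ 0 0 0 0 0 (differentiable_suslovQ hΩ hξ) hz
      · exact sub_eq_zero.1 (dotProduct_self_eq_zero.1
          (by simpa using h' 0 0 0 (Ω a - Ωa) 0 0 d0 hz))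
      · exact sub_eq_zero.1 (dotProduct_self_eq_zero.1
          (by simpa using h' 0 0 0 0 (Ω b - Ωb) 0 d0 hz))
    refine eulerLagrange_of_firstVariation hab hC hκ hΩ hξ hfeas fun δΩ δξ db hv => ?_
    simpa [hfeas.motion b (right_mem_Icc.2 hab.le)] using h' 0 δΩ δξ 0 0 db d0 hv
  · rintro ⟨h, rfl⟩ δκ δΩ δξ dρ dν db hδκ hv
    refine (hasDerivAt_performanceIndex hC hκ hΩ hξ hδκ hv.omega hv.xi hv.left).congr_deriv ?_
    have hP := fun t ht => h.omega_eq t ht ▸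
      (differentiable_momOmega (d := d) hC hκ hΩ hξ t).hasDerivAt
    have hQ := fun t ht => h.xi_eq t ht ▸ (differentiable_momXi hC hκ hΩ hξ t).hasDerivAt
    have i1 := integral_parts_of_hasDerivAt hab.le hP (continuous_forceOmega hC hκ hΩ hξ)
      (fun t => (hv.omega.1 t).hasDerivAt) hv.omega.2.continuous
    have i2 := integral_parts_of_hasDerivAt hab.le hQ (continuous_forceXi hC hκ hΩ hξ)
      (fun t => (hv.xi.1 t).hasDerivAt) hv.xi.2.continuous
    have c1 : Continuous fun t =>
        δΩ t ⬝ᵥ forceOmega d C κ Ω ξ t + deriv δΩ t ⬝ᵥ momOmega d C κ Ω ξ t :=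
      (hv.omega.1.continuous.dotProduct (continuous_forceOmega hC hκ hΩ hξ)).add
        (hv.omega.2.continuous.dotProduct (differentiable_momOmega hC hκ hΩ hξ).continuous)
    have c2 : Continuous fun t =>
        δξ t ⬝ᵥ forceXi d C κ Ω ξ t + deriv δξ t ⬝ᵥ momXi C κ Ω ξ t :=
      (hv.xi.1.continuous.dotProduct (continuous_forceXi hC hκ hΩ hξ)).add
        (hv.xi.2.continuous.dotProduct (differentiable_momXi hC hκ hΩ hξ).continuous)
    have i3 : (∫ t in a..b, (δκ t ⬝ᵥ suslovQ d (Ω t) (deriv Ω t) (ξ t) (deriv ξ t)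
            + (δΩ t ⬝ᵥ forceOmega d C κ Ω ξ t + deriv δΩ t ⬝ᵥ momOmega d C κ Ω ξ t)
            + (δξ t ⬝ᵥ forceXi d C κ Ω ξ t + deriv δξ t ⬝ᵥ momXi C κ Ω ξ t)))
        = δΩ b ⬝ᵥ momOmega d C κ Ω ξ b := by
      rw [h.right_xi, h.left_xi, dotProduct_zero, dotProduct_zero, sub_zero] at i2
      rw [hv.left, zero_dotProduct, sub_zero] at i1
      rw [← add_zero (δΩ b ⬝ᵥ momOmega d C κ Ω ξ b), ← i1, ← i2, ← intervalIntegral.integral_add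
        (c1.intervalIntegrable a b) (c2.intervalIntegrable a b)]
      refine intervalIntegral.integral_congr fun t ht => ?_
      rw [uIcc_of_le hab.le] at ht
      simp only [h.motion t ht, dotProduct_zero, zero_add]
    rw [i3, h.motion b (right_mem_Icc.2 hab.le), h.left_omega, h.right_omega, sub_self, sub_self,
      dotProduct_zero, dotProduct_zero, dotProduct_zero, dotProduct_add, dotProduct_smul,
      neg_dotProduct, neg_dotProduct, dotProduct_comm _ (δΩ b)]
    -- The remaining terms in `db` vanish by transversality if `b` is free and by `db = 0` if it is
    -- fixed.
    have hT : db * (along C Ω ξ b - momOmega d C κ Ω ξ b ⬝ᵥ deriv Ω b) = 0 := by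
      by_cases hfree : freeTime
      · rw [h.right_time hfree, mul_zero]
      · rw [hv.fixed hfree, zero_mul]
    rw [smul_eq_mul]
    linarith

/-- Fermat's rule along each family. The multipliers are not varied here, so the constraints must
come from feasibility. -/
theorem IsMinimizingIndex.eulerLagrange (hab : a < b) (hC : IsRegularCost C)
    (hκ : Differentiable ℝ κ) (hΩ : TwiceDifferentiable Ω) (hξ : TwiceDifferentiable ξ)
    (hfeas : IsFeasible d a b Ωa Ωb Ω ξ)
    (hmin : IsMinimizingIndex d C a Ωa Ωb freeTime κ Ω ξ ρ ν b) :
    EulerLagrange d C a b Ωa Ωb freeTime κ Ω ξ := by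
  refine (eulerLagrange_of_firstVariation hab hC hκ hΩ hξ hfeas (ν := ν) fun δΩ δξ db hv => ?_).1
  have h1 := hasDerivAt_performanceIndex (d := d) (Ωa := Ωa) (Ωb := Ωb) (ρ := ρ) (ν := ν)
    (b := b)
    (dρ := 0) (dν := 0) (db := db) (δκ := 0) hC hκ hΩ hξ (differentiable_const 0) hv.omega hv.xi
    hv.left
  simp only [smul_zero, add_zero] at h1
  have h2 := (hmin δΩ δξ db hv).hasDerivAt_eq_zero h1
  simpa [hfeas.motion b (right_mem_Icc.2 hab.le)] using h2

/-- Expanding `d/dt P` and `d/dt Q` by the product rule makes the two systems rearrangements of each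
other: the derivative of `⟨ξ, 𝕀⁻¹ξ⟩` supplies the last term of `costateBracket`, and that of `⟨κ, ξ⟩
Ω` the terms with `Ω̇`, `⟨κ, ξ̇⟩` and `⟨ξ, κ̇⟩`. -/
theorem eulerLagrange_iff_optimallyControlled (hd : ∀ i, 0 < d i) (hC : IsRegularCost C)
    (hκ : Differentiable ℝ κ) (hΩ : TwiceDifferentiable Ω) (hξ : TwiceDifferentiable ξ)
    (hξ0 : ∀ t ∈ Icc a b, ξ t ≠ 0) :
    EulerLagrange d C a b Ωa Ωb freeTime κ Ω ξ ↔
      OptimallyControlled d C a b Ωa Ωb freeTime κ Ω ξ := by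
  have e1 : ∀ t ∈ Icc a b, (deriv Ω t = omegaDot d (Ω t) (ξ t) (deriv ξ t) ↔
      suslovQ d (Ω t) (deriv Ω t) (ξ t) (deriv ξ t) = 0) := fun t ht => eq_omegaDot_iff hd (hξ0 t ht)
  have e2 : ∀ t ∈ Icc a b, (deriv κ t = (xiSq d (ξ t))⁻¹ • inertiaInv d
      (along (gradOmega C) Ω ξ t - deriv (along (gradOmegaDot C) Ω ξ) t
        + costateBracket d (κ t) (Ω t) (ξ t) (deriv ξ t)) ↔
      deriv (momOmega d C κ Ω ξ) t = forceOmega d C κ Ω ξ t) := by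
    intro t ht
    rw [eq_inv_smul_inertiaInv_iff hd (xiSq_pos hd (hξ0 t ht)).ne',
      (hasDerivAt_momOmega hC hκ hΩ hξ t).deriv, ← sub_eq_zero, ← sub_eq_zero (b := forceOmega d C κ Ω ξ t)]
    refine Eq.congr_left ?_
    simp only [forceOmega, costateBracket, adjOmega]
    abel
  have e3 : ∀ t ∈ Icc a b, (deriv (along (gradXiDot C) Ω ξ) t = along (gradXi C) Ω ξ t
      + controlBracket d (κ t) (Ω t) (deriv Ω t) (ξ t) (deriv ξ t)
      - (ξ t ⬝ᵥ deriv κ t) • Ω t ↔ deriv (momXi C κ Ω ξ) t = forceXi d C κ Ω ξ t) := by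
    intro t _
    rw [(hasDerivAt_momXi hC hκ hΩ hξ t).deriv, ← sub_eq_zero, ← sub_eq_zero (b := forceXi d C κ Ω ξ t)]
    refine Eq.congr_left ?_
    have hin : inertia d (κ t) ⬝ᵥ deriv Ω t = κ t ⬝ᵥ inertia d (deriv Ω t) := by
      simp only [dotProduct, inertia_apply]
      exact Finset.sum_congr rfl fun i _ => by ring
    simp only [forceXi, controlBracket, adjXi, Matrix.sub_mulVec, Matrix.smul_mulVec,
      Matrix.one_mulVec, Matrix.vecMulVec_mulVec, op_smul_eq_smul, dotProduct_sub,
      dotProduct_comm (deriv κ t) (ξ t), hin]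
    module
  constructor
  · intro h
    exact ⟨fun t ht => (e1 t ht).2 (h.motion t ht), fun t ht => (e2 t ht).2 (h.omega_eq t ht),
      fun t ht => (e3 t ht).2 (h.xi_eq t ht), sub_eq_zero.2 h.left_omega, h.left_xi,
      sub_eq_zero.2 h.right_omega, h.right_xi, h.right_time⟩
  · intro h
    exact ⟨fun t ht => (e1 t ht).1 (h.omega_eq t ht), fun t ht => (e2 t ht).1 (h.kappa_eq t ht),
      fun t ht => (e3 t ht).1 (h.xi_eq t ht), sub_eq_zero.1 h.left_omega, h.left_xi,
      sub_eq_zero.1 h.right_omega, h.right_xi, h.right_time⟩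

end

/-! ### The classical Hamiltonian -/

theorem differentiableAt_omegaDot (d : Vec3) {p : Vec3 × Vec3 × Vec3} (h : xiSq d p.2.1 ≠ 0) :
    DifferentiableAt ℝ (fun p : Vec3 × Vec3 × Vec3 => omegaDot d p.1 p.2.1 p.2.2) p := by
  have hx : ∀ i, DifferentiableAt ℝ (fun p : Vec3 × Vec3 × Vec3 => p.1 i) p := by fun_prop
  have hy : ∀ i, DifferentiableAt ℝ (fun p : Vec3 × Vec3 × Vec3 => p.2.1 i) p := by fun_prop
  have hz : ∀ i, DifferentiableAt ℝ (fun p : Vec3 × Vec3 × Vec3 => p.2.2 i) p := by fun_prop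
  have hg : ∀ i, DifferentiableAt ℝ (fun p : Vec3 × Vec3 × Vec3 => gyro d p.1 i) p := by
    intro i
    fin_cases i
    exacts [(((hx 1).const_mul _).mul (hx 2)).sub (((hx 2).const_mul _).mul (hx 1)),
      (((hx 2).const_mul _).mul (hx 0)).sub (((hx 0).const_mul _).mul (hx 2)),
      (((hx 0).const_mul _).mul (hx 1)).sub (((hx 1).const_mul _).mul (hx 0))]
  have hs : DifferentiableAt ℝ (fun p : Vec3 × Vec3 × Vec3 => xiSq d p.2.1) p := by
    simp only [xiSq, dotProduct, inertiaInv_apply]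
    fun_prop
  have hn : DifferentiableAt ℝ (fun p : Vec3 × Vec3 × Vec3 => nOne d p.1 p.2.1 p.2.2) p := by
    simp only [nOne, dotProduct, inertiaInv_apply]
    fun_prop
  refine differentiableAt_pi.2 fun i => ?_
  exact (hs.inv h).mul (((hs.mul (hg i)).sub (hn.mul (hy i))).const_mul (d i)⁻¹)

section
variable {d : Vec3} {C : CostFn}

theorem differentiableAt_hamiltonian (hC : IsRegularCost C) {z : Vec3 × Vec3 × Vec3}
    (h : xiSq d z.2.1 ≠ 0) (p r : Vec3) (t : ℝ) :
    DifferentiableAt ℝ (fun z : Vec3 × Vec3 × Vec3 => hamiltonian d C z.1 z.2.1 z.2.2 p r t) z := by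
  have hf := differentiableAt_omegaDot d h
  have h1 : DifferentiableAt ℝ
      (fun z : Vec3 × Vec3 × Vec3 => costAt C t (z.1, omegaDot d z.1 z.2.1 z.2.2, z.2.1, z.2.2)) z :=
    DifferentiableAt.comp z (hC.differentiable t _) (by fun_prop)
  refine h1.add (DifferentiableAt.add ?_ ?_)
  · exact DifferentiableAt.fun_sum fun i _ => (differentiableAt_pi.1 hf i).const_mul (p i)
  · exact DifferentiableAt.fun_sum fun i _ => by fun_prop

/-- The derivative of the classical Hamiltonian along a curve of states and controls, if the costate
`p` is the one determined by `κ`. -/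
theorem hasDerivAt_hamiltonian (hd : ∀ i, 0 < d i) (hC : IsRegularCost C) {x y w : ℝ → Vec3}
    {u v v' p r κ : Vec3} {s t : ℝ} (hx : HasDerivAt x u s) (hy : HasDerivAt y v s)
    (hw : HasDerivAt w v' s) (hy0 : y s ≠ 0)
    (hp : p + gradOmegaDot C (x s) (omegaDot d (x s) (y s) (w s)) (y s) (w s) t
      = -(xiSq d (y s) • inertia d κ)) :
    HasDerivAt (fun e => hamiltonian d C (x e) (y e) (w e) p r t)
      (u ⬝ᵥ (gradOmega C (x s) (omegaDot d (x s) (y s) (w s)) (y s) (w s) t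
          + adjOmega d κ (x s) (y s) (w s))
        + v ⬝ᵥ (gradXi C (x s) (omegaDot d (x s) (y s) (w s)) (y s) (w s) t
          + adjXi d κ (x s) (omegaDot d (x s) (y s) (w s)) (y s) (w s))
        + v' ⬝ᵥ (gradXiDot C (x s) (omegaDot d (x s) (y s) (w s)) (y s) (w s) t
          + (κ ⬝ᵥ y s) • x s + r)) s := by
  have hf : DifferentiableAt ℝ (fun e => omegaDot d (x e) (y e) (w e)) s :=
    DifferentiableAt.comp (g := fun p : Vec3 × Vec3 × Vec3 => omegaDot d p.1 p.2.1 p.2.2) s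
      (differentiableAt_omegaDot d (xiSq_pos hd hy0).ne')
      (hx.differentiableAt.prodMk (hy.differentiableAt.prodMk hw.differentiableAt))
  -- The derivative of `f` is never computed: the differentiated constraint eliminates it.
  obtain ⟨f', hf'⟩ : ∃ f', HasDerivAt (fun e => omegaDot d (x e) (y e) (w e)) f' s :=
    ⟨_, hf.hasDerivAt⟩
  have hq := hx.suslovQ d hf' hy hw
  have hq0 : (fun e => suslovQ d (x e) (omegaDot d (x e) (y e) (w e)) (y e) (w e)) =ᶠ[𝓝 s]
      fun _ => 0 := by
    filter_upwards [hy.continuousAt.eventually_ne hy0] with e he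
    exact suslovQ_omegaDot hd he _
  have hzero := hq.unique ((hasDerivAt_const s (0 : Vec3)).congr_of_eventuallyEq hq0)
  have hadj := dotProduct_suslovQDiff d κ (x s) u (omegaDot d (x s) (y s) (w s)) f' (y s) v (w s) v'
  rw [hzero, dotProduct_zero] at hadj
  have hH := (hasDerivAt_cost (hC.differentiable t _) hx hf' hy hw).fun_add
    (((hasDerivAt_const s p).vec_dotProduct hf').fun_add
      ((hasDerivAt_const s r).vec_dotProduct hw))
  refine hH.congr_deriv ?_
  -- By `hp` the coefficient of `f'` in the derivative of `H` is `-⟨ξ, 𝕀⁻¹ξ⟩ 𝕀κ`, exactly the term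
  -- that `hadj` trades for the constraint forces.
  have hp' := congrArg (fun z => f' ⬝ᵥ z) hp
  simp only [dotProduct_add, dotProduct_neg, dotProduct_comm f' p] at hp'
  simp only [zero_dotProduct, dotProduct_add, dotProduct_comm r v']
  linarith

variable {Ω ξ u p r κ : Vec3} {t : ℝ}

theorem vgrad_hamiltonian_omega (hd : ∀ i, 0 < d i) (hC : IsRegularCost C) (hξ : ξ ≠ 0)
    (hp : p + gradOmegaDot C Ω (omegaDot d Ω ξ u) ξ u t = -(xiSq d ξ • inertia d κ)) :
    vgrad (fun x => hamiltonian d C x ξ u p r t) Ω =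
      gradOmega C Ω (omegaDot d Ω ξ u) ξ u t + adjOmega d κ Ω ξ u := by
  refine vgrad_eq (DifferentiableAt.comp Ω (f := fun x : Vec3 => (x, ξ, u))
    (differentiableAt_hamiltonian hC (xiSq_pos hd hξ).ne' p r t) (by fun_prop)) fun v => ?_
  have := hasDerivAt_hamiltonian (r := r) (κ := κ) (p := p) (t := t) hd hC (hasDerivAt_add_smul Ω v 0)
    (hasDerivAt_const 0 ξ) (hasDerivAt_const 0 u) hξ (by simpa using hp)
  simpa using this

theorem vgrad_hamiltonian_xi (hd : ∀ i, 0 < d i) (hC : IsRegularCost C) (hξ : ξ ≠ 0)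
    (hp : p + gradOmegaDot C Ω (omegaDot d Ω ξ u) ξ u t = -(xiSq d ξ • inertia d κ)) :
    vgrad (fun x => hamiltonian d C Ω x u p r t) ξ =
      gradXi C Ω (omegaDot d Ω ξ u) ξ u t + adjXi d κ Ω (omegaDot d Ω ξ u) ξ u := by
  refine vgrad_eq (DifferentiableAt.comp ξ (f := fun x : Vec3 => (Ω, x, u))
    (differentiableAt_hamiltonian hC (xiSq_pos hd hξ).ne' p r t) (by fun_prop)) fun v => ?_
  have := hasDerivAt_hamiltonian (r := r) (κ := κ) (p := p) (t := t) hd hC (hasDerivAt_const 0 Ω)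
    (hasDerivAt_add_smul ξ v 0) (hasDerivAt_const 0 u) (by simpa using hξ) (by simpa using hp)
  simpa using this

theorem vgrad_hamiltonian_control (hd : ∀ i, 0 < d i) (hC : IsRegularCost C) (hξ : ξ ≠ 0)
    (hp : p + gradOmegaDot C Ω (omegaDot d Ω ξ u) ξ u t = -(xiSq d ξ • inertia d κ)) :
    vgrad (fun x => hamiltonian d C Ω ξ x p r t) u =
      gradXiDot C Ω (omegaDot d Ω ξ u) ξ u t + (κ ⬝ᵥ ξ) • Ω + r := by
  refine vgrad_eq (DifferentiableAt.comp u (f := fun x : Vec3 => (Ω, ξ, x))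
    (differentiableAt_hamiltonian hC (xiSq_pos hd hξ).ne' p r t) (by fun_prop)) fun v => ?_
  have := hasDerivAt_hamiltonian (r := r) (κ := κ) (p := p) (t := t) hd hC (hasDerivAt_const 0 Ω)
    (hasDerivAt_const 0 ξ) (hasDerivAt_add_smul u v 0) hξ (by simpa using hp)
  simpa using this

theorem vgrad_dotProduct_add (c k : ℝ) (w x : Vec3) :
    vgrad (fun x => c + (x ⬝ᵥ w + k)) x = w := by
  refine vgrad_eq ?_ fun v => ?_
  · simp only [dotProduct]; fun_prop
  · simpa using ((((hasDerivAt_add_smul x v 0).vec_dotProduct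
      (hasDerivAt_const 0 w)).add_const k).const_add c)

theorem vgrad_hamiltonian_costate_omega :
    vgrad (fun x => hamiltonian d C Ω ξ u x r t) p = omegaDot d Ω ξ u :=
  vgrad_dotProduct_add _ _ _ _

theorem vgrad_hamiltonian_costate_xi :
    vgrad (fun x => hamiltonian d C Ω ξ u p x t) r = u := by
  simp only [hamiltonian, add_comm (p ⬝ᵥ omegaDot d Ω ξ u)]
  exact vgrad_dotProduct_add _ _ _ _

end

/-! ### Correspondence between `κ` and the classical costates. -/

section
variable {d : Vec3} {C : CostFn} {a b : ℝ} {Ωa Ωb : Vec3} {freeTime : Prop}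
  {κ Ω ξ p r : ℝ → Vec3}

theorem add_gradOmegaDot_of_eq_neg_momOmega {t : ℝ}
    (hm : deriv Ω t = omegaDot d (Ω t) (ξ t) (deriv ξ t)) (hp : p t = -momOmega d C κ Ω ξ t) :
    p t + gradOmegaDot C (Ω t) (omegaDot d (Ω t) (ξ t) (deriv ξ t)) (ξ t) (deriv ξ t) t
      = -(xiSq d (ξ t) • inertia d (κ t)) := by
  rw [hp, ← hm]
  simp only [momOmega, along]
  abel

/-- The formula for `p`, `r` is assumed only on `[a, b]`, so that the lemma also serves the
converse, where the costates are given. Each equivalence is conditional on the equation of motion,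
since the gradients of `H` are evaluated at `f` and not at `Ω̇`. -/
theorem classicalConditions_iff_eulerLagrange (hd : ∀ i, 0 < d i) (hab : a < b)
    (hC : IsRegularCost C) (hκ : Differentiable ℝ κ) (hΩ : TwiceDifferentiable Ω)
    (hξ : TwiceDifferentiable ξ) (hξ0 : ∀ t ∈ Icc a b, ξ t ≠ 0)
    (hp : Differentiable ℝ p) (hr : Differentiable ℝ r)
    (hpκ : ∀ t ∈ Icc a b, p t = -momOmega d C κ Ω ξ t)
    (hrκ : ∀ t ∈ Icc a b, r t = -momXi C κ Ω ξ t) :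
    ClassicalConditions d C a b Ωa Ωb freeTime Ω ξ p r ↔
      EulerLagrange d C a b Ωa Ωb freeTime κ Ω ξ := by
  have ha := left_mem_Icc.2 hab.le
  have hb := right_mem_Icc.2 hab.le
  have hp' : ∀ t ∈ Icc a b, deriv p t = -deriv (momOmega d C κ Ω ξ) t := fun t ht =>
    (hp t).hasDerivAt.eq_of_eqOn_Icc hab ht
      (differentiable_momOmega hC hκ hΩ hξ t).hasDerivAt.neg hpκ
  have hr' : ∀ t ∈ Icc a b, deriv r t = -deriv (momXi C κ Ω ξ) t := fun t ht =>
    (hr t).hasDerivAt.eq_of_eqOn_Icc hab ht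
      (differentiable_momXi hC hκ hΩ hξ t).hasDerivAt.neg hrκ
  have e1 : ∀ t ∈ Icc a b, deriv Ω t = omegaDot d (Ω t) (ξ t) (deriv ξ t) →
      (deriv p t = -vgrad (fun x => hamiltonian d C x (ξ t) (deriv ξ t) (p t) (r t) t) (Ω t) ↔
        deriv (momOmega d C κ Ω ξ) t = forceOmega d C κ Ω ξ t) := fun t ht hm => by
    rw [vgrad_hamiltonian_omega hd hC (hξ0 t ht)
      (add_gradOmegaDot_of_eq_neg_momOmega hm (hpκ t ht)), ← hm, hp' t ht, neg_inj]
    rfl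
  have e2 : ∀ t ∈ Icc a b, deriv Ω t = omegaDot d (Ω t) (ξ t) (deriv ξ t) →
      (deriv r t = -vgrad (fun x => hamiltonian d C (Ω t) x (deriv ξ t) (p t) (r t) t) (ξ t) ↔
        deriv (momXi C κ Ω ξ) t = forceXi d C κ Ω ξ t) := fun t ht hm => by
    rw [vgrad_hamiltonian_xi hd hC (hξ0 t ht)
      (add_gradOmegaDot_of_eq_neg_momOmega hm (hpκ t ht)), ← hm, hr' t ht, neg_inj]
    rfl
  have e3 : ∀ t ∈ Icc a b, deriv Ω t = omegaDot d (Ω t) (ξ t) (deriv ξ t) →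
      vgrad (fun u => hamiltonian d C (Ω t) (ξ t) u (p t) (r t) t) (deriv ξ t) = 0 :=
    fun t ht hm => by
    rw [vgrad_hamiltonian_control hd hC (hξ0 t ht)
      (add_gradOmegaDot_of_eq_neg_momOmega hm (hpκ t ht)), ← hm, hrκ t ht]
    simp only [momXi, along]
    abel
  have e4 : r b = 0 → deriv Ω b = omegaDot d (Ω b) (ξ b) (deriv ξ b) →
      hamiltonian d C (Ω b) (ξ b) (deriv ξ b) (p b) (r b) b =
        along C Ω ξ b - momOmega d C κ Ω ξ b ⬝ᵥ deriv Ω b := fun hrb hm => by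
    rw [hamiltonian, ← hm, hrb, hpκ b hb, zero_dotProduct, add_zero, neg_dotProduct, ← sub_eq_add_neg]
    rfl
  constructor
  · intro h
    have hm : ∀ t ∈ Icc a b, deriv Ω t = omegaDot d (Ω t) (ξ t) (deriv ξ t) := fun t ht =>
      (h.omega_eq t ht).trans vgrad_hamiltonian_costate_omega
    exact ⟨fun t ht => (eq_omegaDot_iff hd (hξ0 t ht)).1 (hm t ht),
      fun t ht => (e1 t ht (hm t ht)).1 (h.p_eq t ht),
      fun t ht => (e2 t ht (hm t ht)).1 (h.r_eq t ht), h.left_omega,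
      neg_eq_zero.1 ((hrκ a ha).symm.trans h.left_r), h.right_omega,
      neg_eq_zero.1 ((hrκ b hb).symm.trans h.right_r),
      fun hf => (e4 h.right_r (hm b hb)).symm.trans (h.right_time hf)⟩
  · intro h
    have hm : ∀ t ∈ Icc a b, deriv Ω t = omegaDot d (Ω t) (ξ t) (deriv ξ t) := fun t ht =>
      (eq_omegaDot_iff hd (hξ0 t ht)).2 (h.motion t ht)
    have hrb : r b = 0 := (hrκ b hb).trans (neg_eq_zero.2 h.right_xi)
    exact ⟨fun t ht => (hm t ht).trans vgrad_hamiltonian_costate_omega.symm,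
      fun t _ => vgrad_hamiltonian_costate_xi.symm,
      fun t ht => (e1 t ht (hm t ht)).2 (h.omega_eq t ht),
      fun t ht => (e2 t ht (hm t ht)).2 (h.xi_eq t ht),
      fun t ht => e3 t ht (hm t ht), h.left_omega,
      (hrκ a ha).trans (neg_eq_zero.2 h.left_xi), h.right_omega, hrb,
      fun hf => (e4 hrb (hm b hb)).trans (h.right_time hf)⟩

/-- A differentiable positive function that agrees with `⟨ξ, 𝕀⁻¹ξ⟩` on `[a, b]`. -/
theorem exists_pos_extension_xiSq (hd : ∀ i, 0 < d i) (hab : a < b) (hξ : Differentiable ℝ ξ)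
    (hξ0 : ∀ t ∈ Icc a b, ξ t ≠ 0) :
    ∃ s : ℝ → ℝ, Differentiable ℝ s ∧ (∀ t, 0 < s t) ∧ ∀ t ∈ Icc a b, s t = xiSq d (ξ t) := by
  have hs : Differentiable ℝ fun t => xiSq d (ξ t) :=
    fun t => ((hξ t).hasDerivAt.xiSq d).differentiableAt
  obtain ⟨c, hc, hmin⟩ := isCompact_Icc.exists_isMinOn (nonempty_Icc.2 hab.le)
    hs.continuous.continuousOn
  have hst : Differentiable ℝ Real.smoothTransition :=
    (Real.smoothTransition.contDiff (n := 1)).differentiable (by simp)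
  -- Here `xiSq d (ξ c)` is the minimum over `[a, b]`. The added term is positive exactly where `⟨ξ,
  -- 𝕀⁻¹ξ⟩` falls below it, hence zero on `[a, b]`.
  refine ⟨fun t => xiSq d (ξ t) + Real.smoothTransition (xiSq d (ξ c) - xiSq d (ξ t)),
    hs.add (hst.comp (hs.const_sub _)), fun t => ?_, fun t ht => ?_⟩
  · rcases lt_or_ge (xiSq d (ξ t)) (xiSq d (ξ c)) with h | h
    · exact add_pos_of_nonneg_of_pos (xiSq_nonneg hd _)
        (Real.smoothTransition.pos_of_pos (sub_pos.2 h))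
    · exact add_pos_of_pos_of_nonneg ((xiSq_pos hd (hξ0 c hc)).trans_le h)
        (Real.smoothTransition.nonneg _)
  · simp only [Real.smoothTransition.zero_of_nonpos (sub_nonpos.2 (hmin ht)), add_zero]

/-- The relation `p = -P` determines `κ` on `[a, b]`, and `H_u = 0` then yields `r = -Q`. Since `ξ`
may vanish outside `[a, b]`, dividing by the positive extension `s` keeps `κ` differentiable on all
of `ℝ`. -/
theorem exists_multiplier_of_classicalConditions (hd : ∀ i, 0 < d i) (hab : a < b)
    (hC : IsRegularCost C) (hΩ : TwiceDifferentiable Ω) (hξ : TwiceDifferentiable ξ)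
    (hξ0 : ∀ t ∈ Icc a b, ξ t ≠ 0) (hp : Differentiable ℝ p)
    (h : ClassicalConditions d C a b Ωa Ωb freeTime Ω ξ p r) :
    ∃ κ : ℝ → Vec3, Differentiable ℝ κ ∧
      ∀ t ∈ Icc a b, p t = -momOmega d C κ Ω ξ t ∧ r t = -momXi C κ Ω ξ t := by
  obtain ⟨s, hs, hs0, hsξ⟩ := exists_pos_extension_xiSq hd hab hξ.1 hξ0
  have hy : Differentiable ℝ fun t => -(p t + along (gradOmegaDot C) Ω ξ t) :=
    (hp.add (hC.differentiable_along_gradOmegaDot hΩ hξ)).neg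
  refine ⟨fun t => (s t)⁻¹ • inertiaInv d (-(p t + along (gradOmegaDot C) Ω ξ t)),
    fun t => ((hs t).inv (hs0 t).ne').smul ((hy t).hasDerivAt.inertiaInv d).differentiableAt,
    fun t ht => ?_⟩
  have hm : deriv Ω t = omegaDot d (Ω t) (ξ t) (deriv ξ t) :=
    (h.omega_eq t ht).trans vgrad_hamiltonian_costate_omega
  have hpκ : p t = -momOmega d C
      (fun t => (s t)⁻¹ • inertiaInv d (-(p t + along (gradOmegaDot C) Ω ξ t))) Ω ξ t := by
    rw [momOmega, ← hsξ t ht, (eq_inv_smul_inertiaInv_iff hd (hs0 t).ne').1 rfl]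
    abel
  refine ⟨hpκ, ?_⟩
  have ho := h.optimality t ht
  rw [vgrad_hamiltonian_control hd hC (hξ0 t ht)
    (add_gradOmegaDot_of_eq_neg_momOmega hm hpκ), ← hm] at ho
  rw [eq_neg_of_add_eq_zero_right ho, momXi, add_comm]
  rfl

end

/-! ### The particular cost function -/

section
variable {α β γ η δ : ℝ} {Ωd : ℝ → Vec3} {d : Vec3}

theorem hasDerivAt_dotProduct_self_line (x u : Vec3) :
    HasDerivAt (fun s : ℝ => (x + s • u) ⬝ᵥ (x + s • u)) (2 * (u ⬝ᵥ x)) 0 := by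
  refine ((hasDerivAt_add_smul x u 0).vec_dotProduct (hasDerivAt_add_smul x u 0)).congr_deriv ?_
  rw [zero_smul, add_zero, dotProduct_comm x u, two_mul]

theorem gradOmega_suslovCost (x x' y y' : Vec3) (t : ℝ) :
    gradOmega (suslovCost α β γ η δ Ωd) x x' y y' t = γ • (x - Ωd t) := by
  refine vgrad_eq (by simp only [suslovCost, dotProduct]; fun_prop) fun u => ?_
  have h := ((((hasDerivAt_dotProduct_self_line (x - Ωd t) u).const_mul (γ / 2)).const_add
    (α / 4 * (y ⬝ᵥ y - 1) ^ 2 + β / 2 * (y' ⬝ᵥ y'))).add_const (η / 2 * (x' ⬝ᵥ x'))).add_const δ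
  refine (h.congr_deriv ?_).congr_of_eventuallyEq (Eventually.of_forall fun s => ?_)
  · rw [dotProduct_smul, smul_eq_mul]; ring
  · simp only [suslovCost, add_sub_right_comm]

theorem gradOmegaDot_suslovCost (x x' y y' : Vec3) (t : ℝ) :
    gradOmegaDot (suslovCost α β γ η δ Ωd) x x' y y' t = η • x' := by
  refine vgrad_eq (by simp only [suslovCost, dotProduct]; fun_prop) fun u => ?_
  have h := (((hasDerivAt_dotProduct_self_line x' u).const_mul (η / 2)).const_add
    (α / 4 * (y ⬝ᵥ y - 1) ^ 2 + β / 2 * (y' ⬝ᵥ y')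
      + γ / 2 * ((x - Ωd t) ⬝ᵥ (x - Ωd t)))).add_const δ
  exact h.congr_deriv (by rw [dotProduct_smul, smul_eq_mul]; ring)

theorem gradXi_suslovCost (x x' y y' : Vec3) (t : ℝ) :
    gradXi (suslovCost α β γ η δ Ωd) x x' y y' t = (α * (y ⬝ᵥ y - 1)) • y := by
  refine vgrad_eq (by simp only [suslovCost, dotProduct]; fun_prop) fun u => ?_
  have h := ((((((hasDerivAt_dotProduct_self_line y u).sub_const 1).fun_pow 2).const_mul
    (α / 4)).add_const (β / 2 * (y' ⬝ᵥ y'))).add_const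
      (γ / 2 * ((x - Ωd t) ⬝ᵥ (x - Ωd t)))).add_const (η / 2 * (x' ⬝ᵥ x')) |>.add_const δ
  refine h.congr_deriv ?_
  rw [dotProduct_smul, smul_eq_mul, zero_smul, add_zero]
  push_cast
  ring

theorem gradXiDot_suslovCost (x x' y y' : Vec3) (t : ℝ) :
    gradXiDot (suslovCost α β γ η δ Ωd) x x' y y' t = β • y' := by
  refine vgrad_eq (by simp only [suslovCost, dotProduct]; fun_prop) fun u => ?_
  have h := ((((hasDerivAt_dotProduct_self_line y' u).const_mul (β / 2)).const_add
    (α / 4 * (y ⬝ᵥ y - 1) ^ 2)).add_const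
      (γ / 2 * ((x - Ωd t) ⬝ᵥ (x - Ωd t)))).add_const (η / 2 * (x' ⬝ᵥ x')) |>.add_const δ
  exact h.congr_deriv (by rw [dotProduct_smul, smul_eq_mul]; ring)

theorem isRegularCost_suslovCost (hΩd : Continuous Ωd) :
    IsRegularCost (suslovCost α β γ η δ Ωd) where
  continuous := by simp only [suslovCost, dotProduct]; fun_prop
  differentiable t := by simp only [suslovCost, dotProduct]; fun_prop
  continuous_fderiv := by
    -- As `Ω_d` is only continuous, its value becomes an independent vector parameter `p.2`. The
    -- cost is polynomial in this parameter and `z`, and `Ω_d` is composed in afterwards; the time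
    -- argument `0` is a dummy.
    have h : ContDiff ℝ 1 (Function.uncurry
        fun (p : (Vec3 × Vec3 × Vec3 × Vec3) × Vec3) (z : Vec3 × Vec3 × Vec3 × Vec3) =>
          suslovCost α β γ η δ (fun _ => p.2) z.1 z.2.1 z.2.2.1 z.2.2.2 0) := by
      simp only [suslovCost, dotProduct, Function.uncurry_def]; fun_prop
    have h' := (ContDiff.fderiv (n := 0) h contDiff_fst (by simp)).continuous
    exact h'.comp (continuous_fst.prodMk (hΩd.comp continuous_snd))
  differentiable_gradOmegaDot := by simp only [gradOmegaDot_suslovCost]; fun_prop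
  differentiable_gradXiDot := by simp only [gradXiDot_suslovCost]; fun_prop

/-! ### The Sherman-Morrison inversion -/

theorem xiSq2_eq_dotProduct (d ξ : Vec3) : xiSq2 d ξ = inertiaInv d ξ ⬝ᵥ inertiaInv d ξ := by
  simp only [xiSq2, dotProduct, inertiaInv_apply]
  exact Finset.sum_congr rfl fun i _ => by ring

theorem xiSq2_nonneg (d ξ : Vec3) : 0 ≤ xiSq2 d ξ := by
  rw [xiSq2_eq_dotProduct]
  exact Finset.sum_nonneg fun i _ => mul_self_nonneg _

/-- Because `(ΩΩᵀ)² = ⟨Ω, Ω⟩ ΩΩᵀ`, the product stays in the span of `I` and `ΩΩᵀ`, and only the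
coefficient `hc` of `ΩΩᵀ` has to vanish. -/
theorem xiMatrix_mul_xiMatrixInv (hd : ∀ i, 0 < d i) (hβ : 0 < β) (hη : 0 ≤ η) (Ω : Vec3) {ξ : Vec3}
    (hξ : ξ ≠ 0) : xiMatrix d β η Ω ξ * xiMatrixInv d β η Ω ξ = 1 := by
  have hs := xiSq_pos hd hξ
  have hω : 0 ≤ Ω ⬝ᵥ Ω := Finset.sum_nonneg fun i _ => mul_self_nonneg _
  have hden : 0 < β * xiSq d ξ ^ 2 + η * xiSq2 d ξ * (Ω ⬝ᵥ Ω) :=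
    add_pos_of_pos_of_nonneg (mul_pos hβ (pow_pos hs 2))
      (mul_nonneg (mul_nonneg hη (xiSq2_nonneg d ξ)) hω)
  have hV : Matrix.vecMulVec Ω Ω * Matrix.vecMulVec Ω Ω = (Ω ⬝ᵥ Ω) • Matrix.vecMulVec Ω Ω := by
    rw [Matrix.vecMulVec_mul_vecMulVec, Matrix.vecMulVec_smul]
  have hc : (β⁻¹ * (η * xiSq2 d ξ / xiSq d ξ ^ 2)
      - (η * xiSq2 d ξ / (β * xiSq d ξ ^ 2 + η * xiSq2 d ξ * (Ω ⬝ᵥ Ω)))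
      - β⁻¹ * (η * xiSq2 d ξ / (β * xiSq d ξ ^ 2 + η * xiSq2 d ξ * (Ω ⬝ᵥ Ω)))
        * (η * xiSq2 d ξ / xiSq d ξ ^ 2) * (Ω ⬝ᵥ Ω)) = 0 := by
    field_simp
    ring
  have h1 : β⁻¹ * β = 1 := inv_mul_cancel₀ hβ.ne'
  have key : ∀ c e : ℝ, (β • (1 : Matrix (Fin 3) (Fin 3) ℝ) + c • Matrix.vecMulVec Ω Ω)
      * (β⁻¹ • ((1 : Matrix (Fin 3) (Fin 3) ℝ) - e • Matrix.vecMulVec Ω Ω)) =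
      (β⁻¹ * β) • (1 : Matrix (Fin 3) (Fin 3) ℝ)
        + (β⁻¹ * c - (β⁻¹ * β) * e - β⁻¹ * e * c * (Ω ⬝ᵥ Ω)) • Matrix.vecMulVec Ω Ω := by
    intro c e
    simp only [add_mul, mul_sub, smul_mul_assoc, mul_smul_comm, one_mul, mul_one, hV, smul_sub]
    module
  rw [xiMatrix, xiMatrixInv, key, h1, one_mul, hc, zero_smul, add_zero, one_smul]

theorem xiMatrix_mulVec_eq_iff (hd : ∀ i, 0 < d i) (hβ : 0 < β) (hη : 0 ≤ η) (Ω : Vec3) {ξ : Vec3}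
    (hξ : ξ ≠ 0) (v z : Vec3) :
    xiMatrix d β η Ω ξ *ᵥ v = z ↔ v = xiMatrixInv d β η Ω ξ *ᵥ z := by
  have h := xiMatrix_mul_xiMatrixInv hd hβ hη Ω hξ
  constructor
  · rintro rfl
    rw [Matrix.mulVec_mulVec, mul_eq_one_comm.1 h, Matrix.one_mulVec]
  · rintro rfl
    rw [Matrix.mulVec_mulVec, h, Matrix.one_mulVec]

/-! ### The explicit equations -/

/-- The part of `𝕀 Ω̈` that does not contain `ξ̈`. -/
def omegaDDotBracket (d Ω Ω' ξ ξ' : Vec3) : Vec3 :=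
  (inertia d Ω') ⨯₃ Ω + (inertia d Ω) ⨯₃ Ω'
    - (nOne d Ω ξ ξ' / xiSq d ξ) • ξ'
    - ((xiSq d ξ * nOneDot d Ω Ω' ξ ξ'
        - 2 * nOne d Ω ξ ξ' * (ξ' ⬝ᵥ inertiaInv d ξ)) / xiSq d ξ ^ 2) • ξ

/-- The time derivative of the equations of motion, solved for `Ω̈`. -/
theorem eq_of_suslovQDiff_eq_zero (hd : ∀ i, 0 < d i) {Ω Ω' Ω'' ξ ξ' ξ'' : Vec3} (hξ : ξ ≠ 0)
    (hq : suslovQ d Ω Ω' ξ ξ' = 0) (h : suslovQDiff d Ω Ω' Ω' Ω'' ξ ξ' ξ' ξ'' = 0) :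
    Ω'' = inertiaInv d (omegaDDotBracket d Ω Ω' ξ ξ')
      - ((Ω ⬝ᵥ ξ'') / xiSq d ξ) • inertiaInv d ξ := by
  have hs := (xiSq_pos hd hξ).ne'
  have hn : nOneDiff d Ω Ω' ξ ξ' ξ' ξ'' = nOneDot d Ω Ω' ξ ξ' + Ω ⬝ᵥ ξ'' := by
    simp only [nOneDiff, nOneDot, gyroDiff]; ring
  funext i
  have hqi := congrFun hq i
  have hi := congrFun h i
  simp only [suslovQ, suslovQDiff, hn, gyroDiff, Pi.add_apply, Pi.sub_apply, Pi.smul_apply,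
    smul_eq_mul, inertia_apply, Pi.zero_apply] at hqi hi
  simp only [omegaDDotBracket, Pi.add_apply, Pi.sub_apply, Pi.smul_apply, smul_eq_mul,
    inertiaInv_apply]
  have hdi := (hd i).ne'
  generalize (inertia d Ω' ⨯₃ Ω) i = A at *
  generalize (inertia d Ω ⨯₃ Ω') i = B at *
  generalize gyro d Ω i = G at *
  generalize nOneDot d Ω Ω' ξ ξ' = m at *
  generalize nOne d Ω ξ ξ' = n at *
  generalize ξ' ⬝ᵥ inertiaInv d ξ = k at *
  generalize Ω ⬝ᵥ ξ'' = l at *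
  generalize xiSq d ξ = s at *
  field_simp
  -- Subtracting `2⟨ξ̇, 𝕀⁻¹ξ⟩ q` removes `𝕀Ω̇ - (𝕀Ω) × Ω`, as in the quotient rule for `n / ⟨ξ,
  -- 𝕀⁻¹ξ⟩`.
  linear_combination s * hi - 2 * k * hqi

variable {a b : ℝ} {Ωa Ωb : Vec3} {freeTime : Prop} {κ Ω ξ : ℝ → Vec3}

theorem deriv_deriv_eq_of_motion (hd : ∀ i, 0 < d i) (hab : a < b) (hΩ : TwiceDifferentiable Ω)
    (hξ : TwiceDifferentiable ξ) (hξ0 : ∀ t ∈ Icc a b, ξ t ≠ 0)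
    (hm : ∀ t ∈ Icc a b, deriv Ω t = omegaDot d (Ω t) (ξ t) (deriv ξ t)) {t : ℝ}
    (ht : t ∈ Icc a b) :
    deriv (deriv Ω) t = inertiaInv d (omegaDDotBracket d (Ω t) (deriv Ω t) (ξ t) (deriv ξ t))
      - ((Ω t ⬝ᵥ deriv (deriv ξ) t) / xiSq d (ξ t)) • inertiaInv d (ξ t) := by
  have hq : ∀ t ∈ Icc a b, suslovQ d (Ω t) (deriv Ω t) (ξ t) (deriv ξ t) = 0 :=
    fun t ht => (eq_omegaDot_iff hd (hξ0 t ht)).1 (hm t ht)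
  exact eq_of_suslovQDiff_eq_zero hd (hξ0 t ht) (hq t ht)
    (((hΩ.1 t).hasDerivAt.suslovQ d (hΩ.2 t).hasDerivAt (hξ.1 t).hasDerivAt
      (hξ.2 t).hasDerivAt).eq_of_eqOn_Icc hab ht (hasDerivAt_const t 0) hq)

theorem inertiaInv_add (d x y : Vec3) : inertiaInv d (x + y) = inertiaInv d x + inertiaInv d y :=
  funext fun i => mul_add (d i)⁻¹ (x i) (y i)

/-- The term `-η Ω̈` in the costate equation contributes a multiple of `⟨Ω, ξ̈⟩ 𝕀⁻²ξ` to `κ̇`.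
Pairing with `ξ` brings `⟨ξ, 𝕀⁻²ξ⟩ ΩΩᵀ ξ̈` into the control equation; moved to the left, it
completes `xiMatrix`. -/
theorem optimallyControlled_suslovCost_iff (hd : ∀ i, 0 < d i) (hab : a < b)
    (hΩ : TwiceDifferentiable Ω) (hξ : TwiceDifferentiable ξ) (hξ0 : ∀ t ∈ Icc a b, ξ t ≠ 0)
    (hβ : 0 < β) (hη : 0 ≤ η) :
    OptimallyControlled d (suslovCost α β γ η δ Ωd) a b Ωa Ωb freeTime κ Ω ξ ↔
      ExplicitlyControlled d α β γ η δ Ωd a b Ωa Ωb freeTime κ Ω ξ := by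
  have c1 : along (gradOmega (suslovCost α β γ η δ Ωd)) Ω ξ = fun t => γ • (Ω t - Ωd t) :=
    funext fun t => gradOmega_suslovCost ..
  have c2 : along (gradOmegaDot (suslovCost α β γ η δ Ωd)) Ω ξ = fun t => η • deriv Ω t :=
    funext fun t => gradOmegaDot_suslovCost ..
  have c3 : along (gradXi (suslovCost α β γ η δ Ωd)) Ω ξ
      = fun t => (α * (ξ t ⬝ᵥ ξ t - 1)) • ξ t := funext fun t => gradXi_suslovCost ..
  have c4 : along (gradXiDot (suslovCost α β γ η δ Ωd)) Ω ξ = fun t => β • deriv ξ t :=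
    funext fun t => gradXiDot_suslovCost ..
  have c2' : ∀ t, deriv (along (gradOmegaDot (suslovCost α β γ η δ Ωd)) Ω ξ) t
      = η • deriv (deriv Ω) t := fun t => by rw [c2, deriv_fun_const_smul η (hΩ.2 t)]
  have c4' : ∀ t, deriv (along (gradXiDot (suslovCost α β γ η δ Ωd)) Ω ξ) t
      = β • deriv (deriv ξ) t := fun t => by rw [c4, deriv_fun_const_smul β (hξ.2 t)]
  have eκ : ∀ t ∈ Icc a b, (∀ t ∈ Icc a b, deriv Ω t = omegaDot d (Ω t) (ξ t) (deriv ξ t)) →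
      (xiSq d (ξ t))⁻¹ • inertiaInv d
        (along (gradOmega (suslovCost α β γ η δ Ωd)) Ω ξ t
          - deriv (along (gradOmegaDot (suslovCost α β γ η δ Ωd)) Ω ξ) t
          + costateBracket d (κ t) (Ω t) (ξ t) (deriv ξ t)) =
      gVec d γ η (Ωd t) (Ω t) (ξ t) (deriv ξ t) (κ t)
        + (η * (Ω t ⬝ᵥ deriv (deriv ξ) t) / xiSq d (ξ t) ^ 2) •
          inertiaInv d (inertiaInv d (ξ t)) := by
    intro t ht hm
    have hg : gVec d γ η (Ωd t) (Ω t) (ξ t) (deriv ξ t) (κ t) =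
        (xiSq d (ξ t))⁻¹ • inertiaInv d (γ • (Ω t - Ωd t)
          - η • inertiaInv d (omegaDDotBracket d (Ω t) (deriv Ω t) (ξ t) (deriv ξ t))
          + costateBracket d (κ t) (Ω t) (ξ t) (deriv ξ t)) := by
      rw [hm t ht]; rfl
    have hsplit : along (gradOmega (suslovCost α β γ η δ Ωd)) Ω ξ t
          - deriv (along (gradOmegaDot (suslovCost α β γ η δ Ωd)) Ω ξ) t
          + costateBracket d (κ t) (Ω t) (ξ t) (deriv ξ t) =
        (γ • (Ω t - Ωd t)
          - η • inertiaInv d (omegaDDotBracket d (Ω t) (deriv Ω t) (ξ t) (deriv ξ t))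
          + costateBracket d (κ t) (Ω t) (ξ t) (deriv ξ t))
        + (η * ((Ω t ⬝ᵥ deriv (deriv ξ) t) / xiSq d (ξ t))) • inertiaInv d (ξ t) := by
      rw [c2', c1, deriv_deriv_eq_of_motion hd hab hΩ hξ hξ0 hm ht]
      module
    rw [hsplit, inertiaInv_add, smul_add, ← hg, inertiaInv_smul, smul_smul]
    congr 2
    ring
  have eξ : ∀ t ∈ Icc a b, (∀ t ∈ Icc a b, deriv Ω t = omegaDot d (Ω t) (ξ t) (deriv ξ t)) →
      deriv κ t = gVec d γ η (Ωd t) (Ω t) (ξ t) (deriv ξ t) (κ t)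
        + (η * (Ω t ⬝ᵥ deriv (deriv ξ) t) / xiSq d (ξ t) ^ 2) •
          inertiaInv d (inertiaInv d (ξ t)) →
      (deriv (along (gradXiDot (suslovCost α β γ η δ Ωd)) Ω ξ) t =
        along (gradXi (suslovCost α β γ η δ Ωd)) Ω ξ t
          + controlBracket d (κ t) (Ω t) (deriv Ω t) (ξ t) (deriv ξ t)
          - (ξ t ⬝ᵥ deriv κ t) • Ω t ↔
      deriv (deriv ξ) t = xiDDot d α β γ η (Ωd t) (Ω t) (ξ t) (deriv ξ t) (κ t)) := by
    intro t ht hm hκ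
    rw [xiDDot, ← xiMatrix_mulVec_eq_iff hd hβ hη (Ω t) (hξ0 t ht), hκ, c4', c3, dotProduct_add,
      dotProduct_smul, ← xiSq2, ← sub_eq_zero, ← sub_eq_zero (a := xiMatrix _ _ _ _ _ *ᵥ _)]
    refine Eq.congr_left ?_
    simp only [xiMatrix, hVec, ← hm t ht, Matrix.add_mulVec, Matrix.smul_mulVec,
      Matrix.one_mulVec, Matrix.vecMulVec_mulVec, op_smul_eq_smul, smul_eq_mul]
    module
  have eT : along (suslovCost α β γ η δ Ωd) Ω ξ b
      - momOmega d (suslovCost α β γ η δ Ωd) κ Ω ξ b ⬝ᵥ deriv Ω b =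
      α / 4 * (ξ b ⬝ᵥ ξ b - 1) ^ 2 + β / 2 * (deriv ξ b ⬝ᵥ deriv ξ b)
      + γ / 2 * ((Ω b - Ωd b) ⬝ᵥ (Ω b - Ωd b)) + δ
      - η / 2 * (deriv Ω b ⬝ᵥ deriv Ω b)
      - (xiSq d (ξ b) • inertia d (κ b)) ⬝ᵥ deriv Ω b := by
    -- The part `η Ω̇` of `P` contributes `-η |Ω̇|²`, which turns the `+η/2` of the cost into
    -- `-η/2`.
    rw [momOmega, c2]
    simp only [along, suslovCost, add_dotProduct, smul_dotProduct, smul_eq_mul]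
    ring
  have eQ : ∀ t, momXi (suslovCost α β γ η δ Ωd) κ Ω ξ t
      = (κ t ⬝ᵥ ξ t) • Ω t + β • deriv ξ t := fun t => by rw [momXi, c4]
  constructor
  · intro h
    -- The costate equation is kept with `ξ̈` unresolved until the control equation has determined
    -- `ξ̈`.
    have hκ := fun t ht => (h.kappa_eq t ht).trans (eκ t ht h.omega_eq)
    have hx := fun t ht => (eξ t ht h.omega_eq (hκ t ht)).1 (h.xi_eq t ht)
    exact ⟨h.omega_eq, hx, fun t ht => by rw [hκ t ht, kappaDot, ← hx t ht], h.left_omega,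
      (eQ a).symm.trans h.left_xi, h.right_omega, (eQ b).symm.trans h.right_xi,
      fun hf => eT.symm.trans (h.right_time hf)⟩
  · intro h
    have hκ := fun t ht => (h.kappa_eq t ht).trans (by rw [kappaDot, ← h.xi_eq t ht])
    exact ⟨h.omega_eq, fun t ht => (hκ t ht).trans (eκ t ht h.omega_eq).symm,
      fun t ht => (eξ t ht h.omega_eq (hκ t ht)).2 (h.xi_eq t ht), h.left_omega,
      (eQ a).trans h.left_xi, h.right_omega, (eQ b).trans h.right_xi,
      fun hf => eT.trans (h.right_time hf)⟩

end

end

theorem mainTheorem3 (d : Vec3) (hd : ∀ i, 0 < d i) (a b : ℝ) (hab : a < b)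
    (Ωa Ωb : Vec3) (freeTime : Prop) (Ω ξ : ℝ → Vec3)
    (hΩ : TwiceDifferentiable Ω) (hξ : TwiceDifferentiable ξ)
    (hξ0 : ∀ t ∈ Set.Icc a b, ξ t ≠ 0) :
    (∀ C : CostFn, IsRegularCost C →
      -- `dS = 0` is the two-point boundary value problem (with `ν` determined, `ρ` arbitrary)
      (∀ κ : ℝ → Vec3, Differentiable ℝ κ → ∀ ρ ν : Vec3,
        (IsStationaryIndex d C a Ωa Ωb freeTime κ Ω ξ ρ ν b ↔
          OptimallyControlled d C a b Ωa Ωb freeTime κ Ω ξ ∧ ν = -momOmega d C κ Ω ξ b)) ∧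
      -- it is necessary for a feasible minimizer of the performance index
      (∀ κ : ℝ → Vec3, Differentiable ℝ κ → ∀ ρ ν : Vec3,
        IsFeasible d a b Ωa Ωb Ω ξ → IsMinimizingIndex d C a Ωa Ωb freeTime κ Ω ξ ρ ν b →
          OptimallyControlled d C a b Ωa Ωb freeTime κ Ω ξ) ∧
      -- the classical costates are obtained from `κ`
      (∀ κ : ℝ → Vec3, Differentiable ℝ κ →
        (OptimallyControlled d C a b Ωa Ωb freeTime κ Ω ξ ↔
          ClassicalConditions d C a b Ωa Ωb freeTime Ω ξ
            (-momOmega d C κ Ω ξ) (-momXi C κ Ω ξ))) ∧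
      -- every classical costate arises in this way
      (∀ p r : ℝ → Vec3, Differentiable ℝ p → Differentiable ℝ r →
        ClassicalConditions d C a b Ωa Ωb freeTime Ω ξ p r →
          ∃ κ : ℝ → Vec3, Differentiable ℝ κ ∧
            OptimallyControlled d C a b Ωa Ωb freeTime κ Ω ξ ∧
            ∀ t ∈ Set.Icc a b, p t = -momOmega d C κ Ω ξ t ∧ r t = -momXi C κ Ω ξ t)) ∧
    (∀ (α β γ η δ : ℝ) (Ωd : ℝ → Vec3), 0 ≤ α → 0 < β → 0 ≤ γ → 0 ≤ η → 0 ≤ δ →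
      (Continuous Ωd → IsRegularCost (suslovCost α β γ η δ Ωd)) ∧
      -- the Sherman–Morrison inversion
      (∀ x y : Vec3, y ≠ 0 →
        IsUnit (xiMatrix d β η x y) ∧ (xiMatrix d β η x y)⁻¹ = xiMatrixInv d β η x y) ∧
      -- the explicit form of the two-point boundary value problem
      (∀ κ : ℝ → Vec3, Differentiable ℝ κ →
        (OptimallyControlled d (suslovCost α β γ η δ Ωd) a b Ωa Ωb freeTime κ Ω ξ ↔
          ExplicitlyControlled d α β γ η δ Ωd a b Ωa Ωb freeTime κ Ω ξ))) := by
  have hL : ∀ C : CostFn, IsRegularCost C → ∀ κ : ℝ → Vec3, Differentiable ℝ κ →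
      (EulerLagrange d C a b Ωa Ωb freeTime κ Ω ξ ↔
        OptimallyControlled d C a b Ωa Ωb freeTime κ Ω ξ) := fun C hC κ hκ =>
    eulerLagrange_iff_optimallyControlled hd hC hκ hΩ hξ hξ0
  refine ⟨fun C hC => ⟨fun κ hκ ρ ν => ?_, fun κ hκ ρ ν hfeas hmin => ?_, fun κ hκ => ?_,
    fun p r hp hr h => ?_⟩, fun α β γ η δ Ωd _ hβ _ hη _ => ⟨fun hΩd => ?_, fun x y hy => ?_,
    fun κ _ => ?_⟩⟩
  · rw [← hL C hC κ hκ]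
    exact isStationaryIndex_iff_eulerLagrange hab hC hκ hΩ hξ
  · exact (hL C hC κ hκ).1 (hmin.eulerLagrange hab hC hκ hΩ hξ hfeas)
  · rw [← hL C hC κ hκ]
    exact (classicalConditions_iff_eulerLagrange hd hab hC hκ hΩ hξ hξ0
      (differentiable_momOmega hC hκ hΩ hξ).neg (differentiable_momXi hC hκ hΩ hξ).neg
      (fun _ _ => rfl) (fun _ _ => rfl)).symm
  · obtain ⟨κ, hκ, hpr⟩ := exists_multiplier_of_classicalConditions hd hab hC hΩ hξ hξ0 hp h
    exact ⟨κ, hκ, (hL C hC κ hκ).1 ((classicalConditions_iff_eulerLagrange hd hab hC hκ hΩ hξ hξ0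
      hp hr (fun t ht => (hpr t ht).1) (fun t ht => (hpr t ht).2)).1 h), hpr⟩
  · exact isRegularCost_suslovCost hΩd
  · have h := xiMatrix_mul_xiMatrixInv hd hβ hη x hy
    exact ⟨IsUnit.of_mul_eq_one _ h, Matrix.inv_eq_right_inv h⟩
  · exact optimallyControlled_suslovCost_iff hd hab hΩ hξ hξ0 hβ hη
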